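/- Let $M$ and $M'$ be smooth (Hausdorff, second countable) manifolds, $p:M'\to M$ a submersion, $V\subset M$ a closed submanifold of codimension $k$, and $V'=p^{-1}(V)$. Fix smooth positive densities $\mu$ on $M$ and $\mu'$ on $M'$; they identify functions with distributions. A distribution on $M$ is a continuous linear form on $C_c^\infty(M)$, a smooth function $\kappa$ being identified with $f\mapsto\int_M\kappa f\,d\mu$. For $f\in C_c^\infty(M')$ let $p_!(f)\in C_c^\infty(M)$ be its integral along the fibres of $p$ with respect to the fibre density $\mu'/\mu$, i.e. $p_*(f\mu')=p_!(f)\,\mu$. For a distribution $P$ on $M$, $p^!(P)$ is the distribution on $M'$ given by $p^!(P)(f)=P(p_!(f))$. For $m\in\mathbb C$, a distribution $P$ on $M$ belongs to $\mathcal I^m(M,V)$ if it is smooth on $M\setminus V$ and if every point of $V$ has a neighbourhood with coordinates $(x,u)\in\mathbb R^d\times\mathbb R^k$ in which $V=\{u=0\}$ and in which, modulo a smooth function, $$P(f)=\frac1{(2\pi)^k}\int_{\mathbb R^d}\int_{\mathbb R^k}a(x,\xi)\Big(\int_{\mathbb R^k}e^{-i\langle u,\xi\rangle}f(x,u)\,w(x,u)\,du\Big)d\xi\,dx,\qquad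 \mu=w\,dx\,du,$$ for a classical symbol $a\sim\sum_{j\ge0}a_{m-j}$ of order $m$ ($a_{m-j}$ is smooth for $\xi\neq0$ and homogeneous of degree $m-j$ in $\xi$). $\mathcal I^m_c(M,V)$ is the subspace of those $P$ that have compact support. Let $\mathcal N_V^M=TM|_V/TV$ be the normal bundle and $\rho$ a smooth positive density on its fibres. The principal symbol $\sigma_m(P)$ is the function on $(\mathcal N_V^M)^*\setminus V$ that is equal to $r\,a_m$ in such coordinates, where $\rho=r\,|du|$. 1. $V'$ is a closed submanifold of codimension $k$ of $M'$, and the differential of $p$ induces a smooth isomorphism of vector bundles over $V'$ from the normal bundle $\mathcal N_{V'}^{M'}$ to the pull-back $p^*\mathcal N_V^M$. 2. For every distribution $P$ on $M$, the distribution $p^!(P)$ on $M'$ is well defined. Let $P\in\mathcal I^m_c(M,V)$. Then $p^!(P)\in\mathcal I^m(M',V')$, and $p^!(P)\in\mathcal I_c^m(M',V')$ if $p^{-1}(\operatorname{supp}P)$ is compact. Under the identification in 1, and with the density $p^*\rho$ on $\mathcal N_{V'}^{M'}$ (which is again smooth and positive), the principal symbol is $\sigma_m(p^!(P))=\sigma_m(P)\circ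 p$. -/

import Mathlib

open scoped Manifold ContDiff Topology
open MeasureTheory Filter Set

noncomputable section

namespace ConormalPullback

/-- The Euclidean space `ℝⁿ`. -/
abbrev Euc (n : ℕ) : Type := EuclideanSpace ℝ (Fin n)

/-! ## Test functions and distributions on a manifold -/

section Distributions

variable (n : ℕ) (M : Type*) [TopologicalSpace M] [ChartedSpace (Euc n) M]

/-- The space `C_c^∞(M)` of complex valued smooth functions with compact support. -/
def testFunctions : Submodule ℂ (M → ℂ) where
  carrier := {f | ContMDiff (𝓡 n) 𝓘(ℝ, ℂ) ∞ f ∧ HasCompactSupport f}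
  add_mem' := fun hf hg => ⟨hf.1.add hg.1, hf.2.add hg.2⟩
  zero_mem' := ⟨contMDiff_const, HasCompactSupport.zero⟩
  smul_mem' := fun c f hf => ⟨by
    have h : ContMDiff (𝓡 n) 𝓘(ℝ, ℂ) ∞ (fun x => c * f x) :=
      ContDiff.comp_contMDiff (g := fun z : ℂ => c * z) (contDiff_const.mul contDiff_id) hf.1
    exact h, hf.2.smul_left (f := fun _ => c)⟩

variable {n M}

/-- Convergence to `0` of a sequence in `C_c^∞(M)`: the supports stay in a fixed compact set and
all derivatives, read in the charts, converge to `0` uniformly on compact sets. -/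
def TendstoZero (f : ℕ → testFunctions n M) : Prop :=
  (∃ K : Set M, IsCompact K ∧ ∀ i, tsupport (f i : M → ℂ) ⊆ K) ∧
  ∀ (x : M) (j : ℕ) (C : Set (Euc n)), IsCompact C → C ⊆ (chartAt (Euc n) x).target →
    TendstoUniformlyOn
      (fun i z => iteratedFDeriv ℝ j ((f i : M → ℂ) ∘ (chartAt (Euc n) x).symm) z) 0 atTop C

variable (n M)

/-- A distribution on `M`: a linear form on `C_c^∞(M)` that is continuous. (For a linear form on
this strict inductive limit of Fréchet spaces, continuity is sequential continuity at `0`.) -/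
structure Distr where
  /-- the underlying linear form -/
  toLin : testFunctions n M →ₗ[ℂ] ℂ
  tendsto_zero : ∀ f : ℕ → testFunctions n M, TendstoZero f →
    Tendsto (fun i => toLin (f i)) atTop (𝓝 0)

variable {n M}

/-- The support of a distribution. -/
def Distr.support (P : Distr n M) : Set M :=
  {x | ∀ U ∈ 𝓝 x, ∃ f : testFunctions n M, tsupport (f : M → ℂ) ⊆ U ∧ P.toLin f ≠ 0}

end Distributions

/-! ## Charts, smooth densities -/

/-- `e` is a smooth chart of `M` with values in the normed space `F`. -/
structure IsSmoothChart (n : ℕ) {M : Type*} [TopologicalSpace M] [ChartedSpace (Euc n) M]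
    {F : Type*} [NormedAddCommGroup F] [NormedSpace ℝ F] (e : OpenPartialHomeomorph M F) :
    Prop where
  contMDiffOn : ContMDiffOn (𝓡 n) 𝓘(ℝ, F) ∞ e e.source
  contMDiffOn_symm : ContMDiffOn 𝓘(ℝ, F) (𝓡 n) ∞ e.symm e.target

/-- In the chart `e`, the measure `μ` is `w(z) dz` with `w` smooth and positive. -/
structure HasDensityInChart {M : Type*} [TopologicalSpace M] [MeasurableSpace M]
    {F : Type*} [NormedAddCommGroup F] [NormedSpace ℝ F] [MeasureSpace F]
    (μ : Measure M) (e : OpenPartialHomeomorph M F) (w : F → ℝ) : Prop where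
  contDiffOn : ContDiffOn ℝ ∞ w e.target
  pos : ∀ z ∈ e.target, 0 < w z
  map_eq : Measure.map e (μ.restrict e.source) =
    (volume.restrict e.target).withDensity (fun z => ENNReal.ofReal (w z))

/-- `μ` is (the measure of) a smooth positive density on the manifold `M`. -/
def IsSmoothDensity (n : ℕ) {M : Type*} [TopologicalSpace M] [ChartedSpace (Euc n) M]
    [MeasurableSpace M] (μ : Measure M) : Prop :=
  ∀ x : M, ∃ w : Euc n → ℝ, HasDensityInChart μ (chartAt (Euc n) x) w

/-! ## Closed submanifolds and their normal bundle -/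

section Submanifolds

variable {n : ℕ} {M : Type*} [TopologicalSpace M] [ChartedSpace (Euc n) M]

/-- A smooth chart of `M` with values in `ℝᵈ × ℝᵏ` in which `V` is the slice `ℝᵈ × {0}`. -/
structure AdaptedChart (n : ℕ) {M : Type*} [TopologicalSpace M] [ChartedSpace (Euc n) M]
    (V : Set M) (d k : ℕ) where
  /-- the chart -/
  chart : OpenPartialHomeomorph M (Euc d × Euc k)
  smooth : IsSmoothChart n chart
  mem_iff : ∀ y ∈ chart.source, y ∈ V ↔ (chart y).2 = 0

/-- `V` is a closed (embedded) submanifold of codimension `k` of `M`. -/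
def IsClosedSubmanifold (n : ℕ) {M : Type*} [TopologicalSpace M] [ChartedSpace (Euc n) M]
    (V : Set M) (k : ℕ) : Prop :=
  IsClosed V ∧ ∀ y ∈ V, ∃ (d : ℕ) (e : AdaptedChart n V d k), y ∈ e.chart.source

/-- The tangent space `T_yV ⊆ T_yM`: the vectors that are killed by the differentials at `y` of
the smooth functions that vanish on `V` near `y`. -/
def tangentSubspace (n : ℕ) {M : Type*} [TopologicalSpace M] [ChartedSpace (Euc n) M]
    (V : Set M) (y : M) : Submodule ℝ (TangentSpace (𝓡 n) y) where
  carrier := {v | ∀ f : M → ℝ, ContMDiffAt (𝓡 n) 𝓘(ℝ, ℝ) ∞ f y → (∀ᶠ z in 𝓝[V] y, f z = 0) →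
    mfderiv (𝓡 n) 𝓘(ℝ, ℝ) f y v = 0}
  add_mem' := fun hv hw f hf h0 => by rw [map_add, hv f hf h0, hw f hf h0, add_zero]
  zero_mem' := fun f _ _ => map_zero _
  smul_mem' := fun c v hv f hf h0 => by rw [map_smul, hv f hf h0, smul_zero]

/-- The normal space `N_y = T_yM / T_yV`. -/
abbrev NormalSpace (n : ℕ) {M : Type*} [TopologicalSpace M] [ChartedSpace (Euc n) M]
    (V : Set M) (y : M) : Type :=
  TangentSpace (𝓡 n) y ⧸ tangentSubspace n V y

namespace AdaptedChart

variable {V : Set M} {d k : ℕ} (e : AdaptedChart n V d k)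

/-- The second (transverse) component of the differential of an adapted chart. -/
def dNormal (y : M) : TangentSpace (𝓡 n) y →L[ℝ] Euc k :=
  (ContinuousLinearMap.snd ℝ (Euc d) (Euc k)).comp
    (mfderiv (𝓡 n) 𝓘(ℝ, Euc d × Euc k) e.chart y)

theorem mdiff : e.chart.MDifferentiable (𝓡 n) 𝓘(ℝ, Euc d × Euc k) :=
  ⟨e.smooth.contMDiffOn.mdifferentiableOn (by simp),
    e.smooth.contMDiffOn_symm.mdifferentiableOn (by simp)⟩

theorem dNormal_surjective [IsManifold (𝓡 n) ∞ M] {y : M} (hy : y ∈ e.chart.source) :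
    Function.Surjective (e.dNormal y) := by
  have : IsManifold (𝓡 n) 1 M := IsManifold.of_le (n := ∞) (by simp)
  have h1 := e.mdiff.mfderiv_surjective hy
  intro u
  obtain ⟨v, hv⟩ := h1 ((0, u) : Euc d × Euc k)
  exact ⟨v, congrArg Prod.snd hv⟩

theorem mfderiv_coord {y : M} (hy : y ∈ e.chart.source) (l : Euc d × Euc k →L[ℝ] ℝ)
    (v : TangentSpace (𝓡 n) y) :
    mfderiv (𝓡 n) 𝓘(ℝ, ℝ) (fun z => l (e.chart z)) y v =
      l (mfderiv (𝓡 n) 𝓘(ℝ, Euc d × Euc k) e.chart y v) := by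
  have h := (l.hasMFDerivAt (x := e.chart y)).comp y (e.mdiff.mdifferentiableAt hy).hasMFDerivAt
  have h2 := h.mfderiv
  exact congrArg (fun T => T v) h2

theorem tangentSubspace_eq_ker [IsManifold (𝓡 n) ∞ M] {y : M} (hy : y ∈ e.chart.source)
    (hV : y ∈ V) :
    tangentSubspace n V y = LinearMap.ker (e.dNormal y : TangentSpace (𝓡 n) y →ₗ[ℝ] Euc k) := by
  have : IsManifold (𝓡 n) 1 M := IsManifold.of_le (n := ∞) (by simp)
  have hnhds : e.chart.source ∈ 𝓝 y := e.chart.open_source.mem_nhds hy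
  ext v
  rw [LinearMap.mem_ker]
  constructor
  · intro hv
    ext i
    let l : Euc d × Euc k →L[ℝ] ℝ :=
      (EuclideanSpace.proj i : Euc k →L[ℝ] ℝ).comp (ContinuousLinearMap.snd ℝ (Euc d) (Euc k))
    have h := hv (fun z => l (e.chart z))
      (l.contDiff.contMDiff.contMDiffAt.comp y (e.smooth.contMDiffOn.contMDiffAt hnhds)) (by
        filter_upwards [self_mem_nhdsWithin, mem_nhdsWithin_of_mem_nhds hnhds] with z hz hz'
        have h0 := (e.mem_iff z hz').1 hz
        simp [l, h0])
    rw [e.mfderiv_coord hy l v] at h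
    exact h
  · intro hv f hf hf0
    set z₀ := e.chart y with hz₀
    have hz₀t : z₀ ∈ e.chart.target := e.chart.map_source hy
    have hzy : e.chart.symm z₀ = y := e.chart.left_inv hy
    set g : Euc d × Euc k → ℝ := fun z => f (e.chart.symm z) with hg
    have hfd : MDifferentiableAt (𝓡 n) 𝓘(ℝ, ℝ) f (e.chart.symm z₀) := by
      rw [hzy]; exact hf.mdifferentiableAt (by simp)
    have hgd : DifferentiableAt ℝ g z₀ :=
      (hfd.comp z₀ (e.mdiff.mdifferentiableAt_symm hz₀t)).differentiableAt
    have hfg : f =ᶠ[𝓝 y] g ∘ e.chart := by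
      filter_upwards [hnhds] with z hz
      simp [hg, e.chart.left_inv hz]
    have hcomp : mfderiv (𝓡 n) 𝓘(ℝ, ℝ) f y v =
        fderiv ℝ g z₀ (mfderiv (𝓡 n) 𝓘(ℝ, Euc d × Euc k) e.chart y v) := by
      have h := (hgd.hasFDerivAt.hasMFDerivAt).comp y
        (e.mdiff.mdifferentiableAt hy).hasMFDerivAt
      have h2 := (h.congr_of_eventuallyEq hfg).mfderiv
      exact congrArg (fun T => T v) h2
    rw [hcomp]
    set w : Euc d × Euc k := mfderiv (𝓡 n) 𝓘(ℝ, Euc d × Euc k) e.chart y v with hw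
    have hw2 : w.2 = 0 := hv
    have hz2 : z₀.2 = 0 := (e.mem_iff y hy).1 hV
    have hline : HasDerivAt (fun t : ℝ => z₀ + t • w) w 0 := by
      simpa using ((hasDerivAt_id (0 : ℝ)).smul_const w).const_add z₀
    have hz0' : z₀ + (0 : ℝ) • w = z₀ := by simp
    have hd : HasDerivAt (fun t : ℝ => g (z₀ + t • w)) (fderiv ℝ g z₀ w) 0 := by
      have hgd' : HasFDerivAt g (fderiv ℝ g z₀) (z₀ + (0 : ℝ) • w) := by
        rw [hz0']; exact hgd.hasFDerivAt
      exact hgd'.comp_hasDerivAt (0 : ℝ) hline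
    have hcont : Tendsto (fun t : ℝ => z₀ + t • w) (𝓝 0) (𝓝 z₀) := by
      have := hline.continuousAt.tendsto
      rwa [hz0'] at this
    have hzero : (fun t : ℝ => g (z₀ + t • w)) =ᶠ[𝓝 0] fun _ => (0 : ℝ) := by
      have hsymm : Tendsto e.chart.symm (𝓝 z₀) (𝓝 y) := by
        have := (e.chart.continuousAt_symm hz₀t).tendsto
        rwa [hzy] at this
      have h1 : ∀ᶠ t : ℝ in 𝓝 0, e.chart.symm (z₀ + t • w) ∈ V →
          f (e.chart.symm (z₀ + t • w)) = 0 :=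
        (hsymm.comp hcont).eventually (eventually_nhdsWithin_iff.1 hf0)
      have h2 : ∀ᶠ t : ℝ in 𝓝 0, z₀ + t • w ∈ e.chart.target :=
        hcont.eventually (e.chart.open_target.mem_nhds hz₀t)
      filter_upwards [h1, h2] with t ht1 ht2
      apply ht1
      rw [e.mem_iff _ (e.chart.map_target ht2), e.chart.right_inv ht2]
      simp [hz2, hw2]
    exact hd.unique ((hasDerivAt_const (0 : ℝ) (0 : ℝ)).congr_of_eventuallyEq hzero)

/-- The trivialisation of the normal bundle over `V ∩ e.chart.source` given by an adapted chart
`e = (e₁, e₂)`: it maps the class of `v` to `de₂(v)`. -/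
def normalTriv [IsManifold (𝓡 n) ∞ M] (y : M) (hy : y ∈ e.chart.source) (hV : y ∈ V) :
    NormalSpace n V y ≃ₗ[ℝ] Euc k :=
  (Submodule.quotEquivOfEq _ _ (e.tangentSubspace_eq_ker hy hV)).trans
    (LinearMap.quotKerEquivOfSurjective (e.dNormal y : TangentSpace (𝓡 n) y →ₗ[ℝ] Euc k)
      (e.dNormal_surjective hy))

end AdaptedChart

/-- The conormal covector `v ↦ ⟨ξ, de₂(v)⟩` with coordinates `ξ` in the adapted chart `e`. -/
def AdaptedChart.covector [IsManifold (𝓡 n) ∞ M] {V : Set M} {d k : ℕ} (e : AdaptedChart n V d k)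
    (y : M) (hy : y ∈ e.chart.source) (hV : y ∈ V) (ξ : Euc k) :
    Module.Dual ℝ (NormalSpace n V y) :=
  (innerSL ℝ ξ : Euc k →ₗ[ℝ] ℝ) ∘ₗ (e.normalTriv y hy hV).toLinearMap

/-- The volume of the frame `b` of `N_y` for the Lebesgue measure of the fibre coordinates of the
adapted chart `e`. -/
def AdaptedChart.frameVolume [IsManifold (𝓡 n) ∞ M] {V : Set M} {d k : ℕ}
    (e : AdaptedChart n V d k) (y : M) (hy : y ∈ e.chart.source) (hV : y ∈ V)
    (b : Fin k → NormalSpace n V y) : ℝ :=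
  |(Matrix.of fun i j => (e.normalTriv y hy hV (b j)) i).det|

/-- `ρ` is a smooth positive density on the fibres of the normal bundle of `V`; `ρ y b` is the
volume in `N_y` of the parallelepiped spanned by `b`. -/
def IsNormalDensity (n : ℕ) {M : Type*} [TopologicalSpace M] [ChartedSpace (Euc n) M]
    [IsManifold (𝓡 n) ∞ M] (V : Set M) (k : ℕ)
    (ρ : ∀ y : V, (Fin k → NormalSpace n V (y : M)) → ℝ) : Prop :=
  ∀ y₀ : V, ∃ (d : ℕ) (e : AdaptedChart n V d k) (r : M → ℝ), (y₀ : M) ∈ e.chart.source ∧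
    ContMDiffOn (𝓡 n) 𝓘(ℝ, ℝ) ∞ r e.chart.source ∧ (∀ y ∈ e.chart.source, 0 < r y) ∧
    ∀ (y : V) (hy : (y : M) ∈ e.chart.source) (b : Fin k → NormalSpace n V (y : M)),
      ρ y b = r y * e.frameVolume y hy y.2 b

end Submanifolds

/-- A family `Φ` of linear isomorphisms from the normal spaces of `p⁻¹(V)` at `x` to those of `V`
at `p x` is a smooth isomorphism of vector bundles over `p⁻¹(V)` from the normal bundle of
`p⁻¹(V)` to the pull-back by `p` of the normal bundle of `V`: in the trivialisations, it is given
by matrices that depend smoothly on the point of `p⁻¹(V)`. -/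
def IsSmoothNormalIso {n n' : ℕ} {M M' : Type*}
    [TopologicalSpace M] [ChartedSpace (Euc n) M] [IsManifold (𝓡 n) ∞ M]
    [TopologicalSpace M'] [ChartedSpace (Euc n') M'] [IsManifold (𝓡 n') ∞ M']
    (p : M' → M) (V : Set M) (k : ℕ)
    (Φ : ∀ x : ↥(p ⁻¹' V), NormalSpace n' (p ⁻¹' V) (x : M') ≃ₗ[ℝ] NormalSpace n V (p x)) :
    Prop :=
  ∀ (d d' : ℕ) (e : AdaptedChart n V d k) (e' : AdaptedChart n' (p ⁻¹' V) d' k),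
    ∃ G : M' → (Euc k →L[ℝ] Euc k),
      ContMDiffOn (𝓡 n') 𝓘(ℝ, Euc k →L[ℝ] Euc k) ∞ G
        (p ⁻¹' V ∩ (e'.chart.source ∩ p ⁻¹' e.chart.source)) ∧
      ∀ (x : ↥(p ⁻¹' V)) (hx : (x : M') ∈ e'.chart.source) (hpx : p x ∈ e.chart.source)
        (v : NormalSpace n' (p ⁻¹' V) (x : M')),
        e.normalTriv (p x) hpx x.2 (Φ x v) = G x (e'.normalTriv x hx x.2 v)

/-! ## Classical symbols and conormal distributions -/

/-- `a` is a classical symbol of order `m` on `ℝᵈ × ℝᵏ` (a family of symbols in `ξ ∈ ℝᵏ` indexed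
by `x ∈ ℝᵈ`) with asymptotic expansion `a ∼ ∑ⱼ A j`, where `A j` is smooth off `ξ = 0` and
homogeneous of degree `m - j` in `ξ`. -/
structure IsClassicalSymbol {d k : ℕ} (m : ℂ) (a : Euc d → Euc k → ℂ)
    (A : ℕ → Euc d → Euc k → ℂ) : Prop where
  smooth : ContDiff ℝ ∞ (fun z : Euc d × Euc k => a z.1 z.2)
  smooth_term : ∀ j, ContDiffOn ℝ ∞ (fun z : Euc d × Euc k => A j z.1 z.2) {z | z.2 ≠ 0}
  homogeneous : ∀ (j : ℕ) (x : Euc d) (ξ : Euc k) (t : ℝ), ξ ≠ 0 → 0 < t →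
    A j x (t • ξ) = (t : ℂ) ^ (m - (j : ℂ)) * A j x ξ
  asymptotic : ∀ (N i l : ℕ) (K : Set (Euc d)), IsCompact K → ∃ C : ℝ, ∀ x ∈ K, ∀ ξ : Euc k,
    1 ≤ ‖ξ‖ →
    ‖iteratedFDeriv ℝ i
        (fun x' => iteratedFDeriv ℝ l (fun ξ' => a x' ξ' - ∑ j ∈ Finset.range N, A j x' ξ') ξ) x‖
      ≤ C * ‖ξ‖ ^ (m.re - (N : ℝ) - (l : ℝ))

/-- `(2π)⁻ᵏ ∫∫ a(x,ξ) F̂(x,ξ) dξ dx`, where `F̂(x,ξ) = ∫ e^{-i⟨u,ξ⟩} F(x,u) du`. -/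
def symbolPairing {d k : ℕ} (a : Euc d → Euc k → ℂ) (F : Euc d × Euc k → ℂ) : ℂ :=
  (((2 * Real.pi) ^ k : ℝ) : ℂ)⁻¹ * ∫ x : Euc d, ∫ ξ : Euc k, a x ξ *
    ∫ u : Euc k, Complex.exp (-Complex.I * (inner ℝ u ξ : ℝ)) * F (x, u)

section ConormalDistributions

variable {n : ℕ} {M : Type*} [TopologicalSpace M] [ChartedSpace (Euc n) M] [MeasurableSpace M]

/-- On the open set `U`, the distribution `P` is the smooth function `κ` (a function `κ` being
identified with the distribution `f ↦ ∫ κ f dμ`). -/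
def IsSmoothOn (μ : Measure M) (P : Distr n M) (U : Set M) (κ : M → ℂ) : Prop :=
  ContMDiffOn (𝓡 n) 𝓘(ℝ, ℂ) ∞ κ U ∧
  ∀ f : testFunctions n M, tsupport (f : M → ℂ) ⊆ U →
    P.toLin f = ∫ y, κ y * (f : M → ℂ) y ∂μ

/-- In the domain of the adapted chart `e`, the distribution `P` is the sum of the conormal
distribution with total symbol `a ∼ ∑ⱼ A j` and of a smooth function: if `μ = w(x,u) dx du` in the
chart, then `P(f) = (2π)⁻ᵏ ∫∫ a(x,ξ) (∫ e^{-i⟨u,ξ⟩} f(x,u) w(x,u) du) dξ dx + ∫ κ f dμ`. -/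
def HasTotalSymbol {V : Set M} {d k : ℕ} (m : ℂ) (μ : Measure M) (P : Distr n M)
    (e : AdaptedChart n V d k) (a : Euc d → Euc k → ℂ) (A : ℕ → Euc d → Euc k → ℂ) : Prop :=
  IsClassicalSymbol m a A ∧
  ∃ (w : Euc d × Euc k → ℝ) (κ : M → ℂ), HasDensityInChart μ e.chart w ∧
    ContMDiffOn (𝓡 n) 𝓘(ℝ, ℂ) ∞ κ e.chart.source ∧
    ∀ f : testFunctions n M, tsupport (f : M → ℂ) ⊆ e.chart.source →
      P.toLin f =
        symbolPairing a
          (e.chart.target.indicator fun z => (f : M → ℂ) (e.chart.symm z) * (w z : ℂ)) +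
        ∫ y, κ y * (f : M → ℂ) y ∂μ

/-- `P` is a (classical) conormal distribution of order `m` with respect to the closed submanifold
`V` of codimension `k`: it is smooth off `V` and, near each point of `V`, the sum of a conormal
distribution given by a classical symbol of order `m` and of a smooth function. No condition on
the support. -/
def IsConormal (m : ℂ) (μ : Measure M) (V : Set M) (k : ℕ) (P : Distr n M) : Prop :=
  (∀ x ∉ V, ∃ U κ, IsOpen U ∧ x ∈ U ∧ IsSmoothOn μ P U κ) ∧
  ∀ y₀ ∈ V, ∃ (d : ℕ) (e : AdaptedChart n V d k) (a : Euc d → Euc k → ℂ)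
    (A : ℕ → Euc d → Euc k → ℂ), y₀ ∈ e.chart.source ∧ HasTotalSymbol m μ P e a A

/-- The space `𝓘_c^m(M,V)` of conormal distributions with compact support. -/
def IsConormalC (m : ℂ) (μ : Measure M) (V : Set M) (k : ℕ) (P : Distr n M) : Prop :=
  IsConormal m μ V k P ∧ IsCompact P.support

/-- `P` is a conormal distribution of order `m` whose principal symbol is the function `σ` on the
complement of the zero section in the dual of the normal bundle (the values of `σ` on the zero
section are irrelevant). The density `ρ` on the normal bundle turns the principal symbol into a
function: if `ρ` is `r |du|` in the fibre coordinates `u` of an adapted chart, and if the total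
symbol of `P` in this chart is `a ∼ A 0 + A 1 + ⋯`, then `σ` is `r A 0`. -/
def HasPrincipalSymbol [IsManifold (𝓡 n) ∞ M] (m : ℂ) (μ : Measure M) (V : Set M) (k : ℕ)
    (ρ : ∀ y : V, (Fin k → NormalSpace n V (y : M)) → ℝ) (P : Distr n M)
    (σ : ∀ y : V, Module.Dual ℝ (NormalSpace n V (y : M)) → ℂ) : Prop :=
  (∀ x ∉ V, ∃ U κ, IsOpen U ∧ x ∈ U ∧ IsSmoothOn μ P U κ) ∧
  ∀ y₀ ∈ V, ∃ (d : ℕ) (e : AdaptedChart n V d k) (a : Euc d → Euc k → ℂ)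
    (A : ℕ → Euc d → Euc k → ℂ), y₀ ∈ e.chart.source ∧ HasTotalSymbol m μ P e a A ∧
    ∀ (y : V) (hy : (y : M) ∈ e.chart.source) (ξ : Euc k), ξ ≠ 0 →
      ∀ b : Fin k → NormalSpace n V (y : M),
        σ y (e.covector y hy y.2 ξ) * (e.frameVolume y hy y.2 b : ℂ) =
          (ρ y b : ℂ) * A 0 (e.chart y).1 ξ

end ConormalDistributions

/-! ## Pull-back by a submersion -/

section PullBack

variable {n n' : ℕ} {M M' : Type*}
  [TopologicalSpace M] [ChartedSpace (Euc n) M] [MeasurableSpace M]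
  [TopologicalSpace M'] [ChartedSpace (Euc n') M'] [MeasurableSpace M']

/-- `g = p_!(f)` is the integral of `f` along the fibres of `p`, with respect to the quotient
density `μ' / μ` on the fibres: the direct image by `p` of the density `f μ'` is `g μ`. -/
def IsFiberIntegral (μ : Measure M) (μ' : Measure M') (p : M' → M)
    (f : testFunctions n' M') (g : testFunctions n M) : Prop :=
  ∀ h : testFunctions n M,
    ∫ x, (h : M → ℂ) (p x) * (f : M' → ℂ) x ∂μ' = ∫ y, (h : M → ℂ) y * (g : M → ℂ) y ∂μ

/-- `P' = p^!(P)`, that is, `P'(f) = P(p_!(f))` for every `f ∈ C_c^∞(M')`. -/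
def IsPullback (μ : Measure M) (μ' : Measure M') (p : M' → M) (P : Distr n M)
    (P' : Distr n' M') : Prop :=
  ∀ f : testFunctions n' M', ∃ g : testFunctions n M,
    IsFiberIntegral μ μ' p f g ∧ P'.toLin f = P.toLin g

end PullBack

end ConormalPullback

end

/-!
Everything happens in a chart of `M'` at `x` that splits a given chart of `M` at `p x`: there `p`
is the projection `(y, z) ↦ y`. With the densities `μ = w(y) dy` and `μ' = w'(y, z) dy dz`, the
integration along the fibres is the partial integral `w · p_! f = ∫ w'(·, z) f(·, z) dz`. It is
therefore continuous on `C_c^∞`, as a partition of unity reduces any compact support to finitely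
many such charts, and a distribution that is the function `κ` on `U` pulls back to `κ ∘ p` on
`p⁻¹(U)`.

If the chart of `M` is adapted to `V`, so that `y = (x, u)`, then `((x, z), u)` is a chart adapted
to `p⁻¹(V)` with the same transverse coordinates `u`. Integrating over `z` commutes with the Fourier
transform in `u`, and by Fubini `p^! P` has the total symbol `a'((x, z), ξ) = a(x, ξ)`. The Fubini
theorem applies although `a` may grow: the Fourier transform in `u` of a test function decays faster
than any power of `ξ`. Since the transverse coordinates agree, the differential of `p` is the
identity in the trivialisations of the two normal bundles, and hence preserves principal symbols.
-/

noncomputable section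

namespace ConormalPullback

/-! ## Integration over the second factor of a product -/

theorem integrable_slice {Y Z E : Type*} [TopologicalSpace Y] [TopologicalSpace Z] [R1Space Z]
    [MeasurableSpace Z] [OpensMeasurableSpace Z] [NormedAddCommGroup E] (ν : Measure Z)
    [IsFiniteMeasureOnCompacts ν] {φ : Y × Z → E} (hφ : Continuous φ) (hc : HasCompactSupport φ)
    (y : Y) : Integrable (fun z => φ (y, z)) ν :=
  (hφ.comp (by fun_prop : Continuous fun z => (y, z))).integrable_of_hasCompactSupport
    (HasCompactSupport.of_support_subset_isCompact (hc.isCompact.image continuous_snd)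
      fun z hz => ⟨(y, z), subset_tsupport _ hz, rfl⟩)

section PartialIntegral

variable {F H E : Type*} [NormedAddCommGroup F] [NormedSpace ℝ F]
  [NormedAddCommGroup H] [NormedSpace ℝ H] [NormedAddCommGroup E] [NormedSpace ℝ E]
  {φ : F × H → E}

theorem iteratedFDeriv_slice (hφ : ContDiff ℝ ∞ φ) (j : ℕ) (y : F) (z : H) :
    iteratedFDeriv ℝ j (fun y => φ (y, z)) y =
      (iteratedFDeriv ℝ j φ (y, z)).compContinuousLinearMap
        fun _ => ContinuousLinearMap.inl ℝ F H := by
  have hφz : ContDiff ℝ ∞ fun v => φ (v + (0, z)) := by fun_prop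
  have h := (ContinuousLinearMap.inl ℝ F H).iteratedFDeriv_comp_right hφz y (i := j)
    (by exact_mod_cast le_top)
  rw [iteratedFDeriv_comp_add_right] at h
  simpa [Function.comp_def] using h

theorem norm_iteratedFDeriv_slice_le (hφ : ContDiff ℝ ∞ φ) (j : ℕ) (y : F) (z : H) :
    ‖iteratedFDeriv ℝ j (fun y => φ (y, z)) y‖ ≤ ‖iteratedFDeriv ℝ j φ (y, z)‖ := by
  rw [iteratedFDeriv_slice hφ]
  refine (ContinuousMultilinearMap.norm_compContinuousLinearMap_le _ _).trans
    (mul_le_of_le_one_right (norm_nonneg _) (Finset.prod_le_one (fun _ _ => norm_nonneg _) ?_))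
  exact fun _ _ => ContinuousLinearMap.opNorm_le_bound _ zero_le_one fun v => by simp

theorem contDiff_iteratedFDeriv_slice (hφ : ContDiff ℝ ∞ φ) (j : ℕ) :
    ContDiff ℝ ∞ fun w : F × H => iteratedFDeriv ℝ j (fun y => φ (y, w.2)) w.1 := by
  simp only [iteratedFDeriv_slice hφ]
  exact (ContinuousMultilinearMap.compContinuousLinearMapL
    fun _ : Fin j => ContinuousLinearMap.inl ℝ F H).contDiff.comp
    (hφ.iteratedFDeriv_right (m := ∞) (i := j) (by exact_mod_cast le_top))

theorem tsupport_iteratedFDeriv_slice_subset (hφ : ContDiff ℝ ∞ φ) (j : ℕ) :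
    tsupport (fun w : F × H => iteratedFDeriv ℝ j (fun y => φ (y, w.2)) w.1) ⊆ tsupport φ := by
  refine closure_minimal (fun w hw => support_iteratedFDeriv_subset (𝕜 := ℝ) j fun h => hw ?_)
    isClosed_closure
  simp only [iteratedFDeriv_slice hφ, h]
  rfl

variable [MeasurableSpace H] [BorelSpace H] (ν : Measure H) [IsFiniteMeasureOnCompacts ν]

theorem hasFDerivAt_partialIntegral (hφ : ContDiff ℝ ∞ φ) (hc : HasCompactSupport φ) (y : F) :
    HasFDerivAt (fun y => ∫ z, φ (y, z) ∂ν) (∫ z, fderiv ℝ (fun y => φ (y, z)) y ∂ν) y := by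
  set ψ : F × H → F →L[ℝ] E :=
    fun w => (fderiv ℝ φ w).comp (ContinuousLinearMap.inl ℝ F H) with hψ
  have hderiv (y : F) (z : H) : HasFDerivAt (fun y => φ (y, z)) (ψ (y, z)) y :=
    (hφ.differentiable (by simp) _).hasFDerivAt.comp y (hasFDerivAt_prodMk_left y z)
  have hψc : Continuous ψ := by
    have := hφ.continuous_fderiv (by simp)
    fun_prop
  have hψs : HasCompactSupport ψ :=
    (hc.fderiv (𝕜 := ℝ)).mono fun w hw h => hw (by simp [hψ, h])
  obtain ⟨C, hC⟩ := hψc.bounded_above_of_compact_support hψs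
  set K : Set H := Prod.snd '' tsupport ψ
  have hKc : IsCompact K := hψs.isCompact.image continuous_snd
  simp only [(hderiv y _).fderiv]
  refine hasFDerivAt_integral_of_dominated_of_fderiv_le (s := univ) (F' := fun y z => ψ (y, z))
    (bound := K.indicator fun _ => C) univ_mem
    (Eventually.of_forall fun y' => (integrable_slice ν hφ.continuous hc y').1)
    (integrable_slice ν hφ.continuous hc y) (integrable_slice ν hψc hψs y).1 ?_
    ((integrable_indicator_iff hKc.measurableSet).2 (integrableOn_const hKc.measure_lt_top.ne))
    (Eventually.of_forall fun z y' _ => hderiv y' z)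
  refine Eventually.of_forall fun z y' _ => ?_
  by_cases hz : z ∈ K
  · simpa [hz] using hC (y', z)
  · have : ψ (y', z) = 0 := by
      by_contra h
      exact hz ⟨(y', z), subset_tsupport _ h, rfl⟩
    simp [this, hz]

theorem iteratedFDeriv_partialIntegral (hφ : ContDiff ℝ ∞ φ) (hc : HasCompactSupport φ) (j : ℕ) :
    iteratedFDeriv ℝ j (fun y => ∫ z, φ (y, z) ∂ν) =
      fun y => ∫ z, iteratedFDeriv ℝ j (fun y => φ (y, z)) y ∂ν := by
  induction j with
  | zero =>
    ext1 y
    exact ((continuousMultilinearCurryFin0 ℝ F E).symm.toContinuousLinearEquiv.integral_comp_comm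
      fun z => φ (y, z)).symm
  | succ j ih =>
    ext1 y
    have h := (hasFDerivAt_partialIntegral ν (contDiff_iteratedFDeriv_slice hφ j)
      (hc.of_isClosed_subset (isClosed_tsupport _)
        (tsupport_iteratedFDeriv_slice_subset hφ j)) y).fderiv
    simp only [iteratedFDeriv_succ_eq_comp_left, Function.comp_apply, ih, h]
    let L : (F →L[ℝ] F [×j]→L[ℝ] E) ≃L[ℝ] F [×j + 1]→L[ℝ] E :=
      (continuousMultilinearCurryLeftEquiv ℝ (fun _ => F) E).symm.toContinuousLinearEquiv
    exact (ContinuousLinearEquiv.integral_comp_comm (𝕜 := ℝ) L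
      fun z => fderiv ℝ (iteratedFDeriv ℝ j fun y => φ (y, z)) y).symm

theorem contDiff_partialIntegral (hφ : ContDiff ℝ ∞ φ) (hc : HasCompactSupport φ) :
    ContDiff ℝ ∞ fun y => ∫ z, φ (y, z) ∂ν := by
  refine contDiff_of_differentiable_iteratedFDeriv fun j _ => ?_
  rw [iteratedFDeriv_partialIntegral ν hφ hc]
  exact fun y => (hasFDerivAt_partialIntegral ν (contDiff_iteratedFDeriv_slice hφ j)
    (hc.of_isClosed_subset (isClosed_tsupport _)
      (tsupport_iteratedFDeriv_slice_subset hφ j)) y).differentiableAt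

theorem norm_iteratedFDeriv_partialIntegral_le (hφ : ContDiff ℝ ∞ φ) {K : Set (F × H)}
    (hK : IsCompact K) (hφK : tsupport φ ⊆ K) {B : ℝ} {j : ℕ}
    (hB : ∀ w, ‖iteratedFDeriv ℝ j φ w‖ ≤ B) (y : F) :
    ‖iteratedFDeriv ℝ j (fun y => ∫ z, φ (y, z) ∂ν) y‖ ≤ B * ν.real (Prod.snd '' K) := by
  have hc : HasCompactSupport φ := hK.of_isClosed_subset (isClosed_tsupport _) hφK
  simp only [iteratedFDeriv_partialIntegral ν hφ hc]
  rw [← setIntegral_eq_integral_of_forall_compl_eq_zero (s := Prod.snd '' K) fun z hz => ?_]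
  · exact norm_setIntegral_le_of_norm_le_const (hK.image continuous_snd).measure_lt_top
      fun z _ => (norm_iteratedFDeriv_slice_le hφ j y z).trans (hB _)
  · by_contra h
    exact hz ⟨(y, z), hφK (tsupport_iteratedFDeriv_slice_subset hφ j
      (subset_tsupport _ (show iteratedFDeriv ℝ j _ _ ≠ 0 from h))), rfl⟩

end PartialIntegral

/-! ## Sequences of smooth functions that tend to zero with all their derivatives -/

section SmoothCvg

variable {F G E : Type*} [NormedAddCommGroup F] [NormedSpace ℝ F]
  [NormedAddCommGroup G] [NormedSpace ℝ G] [NormedAddCommGroup E] [NormedSpace ℝ E]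

/-- Convergence to `0` in `C^∞(Ω, E)`: the functions `φ i` are smooth on `Ω` and tend to `0` with
all their derivatives, uniformly on the compact subsets of `Ω`. -/
structure SmoothCvgZero (Ω : Set F) (φ : ℕ → F → E) : Prop where
  contDiffOn : ∀ i, ContDiffOn ℝ ∞ (φ i) Ω
  tendstoUniformlyOn : ∀ (j : ℕ) (C : Set F), IsCompact C → C ⊆ Ω →
    TendstoUniformlyOn (fun i => iteratedFDeriv ℝ j (φ i)) 0 atTop C

theorem exists_norm_iteratedFDeriv_le {Ω : Set F} (hΩ : IsOpen Ω) {g : F → E}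
    (hg : ContDiffOn ℝ ∞ g Ω) {C : Set F} (hC : IsCompact C) (hCΩ : C ⊆ Ω) (j : ℕ) :
    ∃ B : ℝ, 1 ≤ B ∧ ∀ l ≤ j, ∀ z ∈ C, ‖iteratedFDeriv ℝ l g z‖ ≤ B := by
  have hbound (l : ℕ) : ∃ B : ℝ, ∀ z ∈ C, ‖iteratedFDeriv ℝ l g z‖ ≤ B :=
    hC.exists_bound_of_continuousOn fun z hz =>
      ((hg.contDiffAt (hΩ.mem_nhds (hCΩ hz))).continuousAt_iteratedFDeriv
        (by exact_mod_cast le_top)).continuousWithinAt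
  choose B hB using hbound
  refine ⟨1 + ∑ l ∈ Finset.range (j + 1), |B l|,
    le_add_of_nonneg_right (by positivity), fun l hl z hz => ?_⟩
  calc ‖iteratedFDeriv ℝ l g z‖ ≤ |B l| := (hB l z hz).trans (le_abs_self _)
    _ ≤ ∑ l ∈ Finset.range (j + 1), |B l| :=
      Finset.single_le_sum (f := fun l => |B l|) (fun _ _ => abs_nonneg _)
        (Finset.mem_range_succ_iff.2 hl)
    _ ≤ 1 + ∑ l ∈ Finset.range (j + 1), |B l| := le_add_of_nonneg_left zero_le_one

namespace SmoothCvgZero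

variable {Ω : Set F} {φ : ℕ → F → E}

theorem congr (h : SmoothCvgZero Ω φ) (hΩ : IsOpen Ω) {ψ : ℕ → F → E}
    (hψ : ∀ i, EqOn (ψ i) (φ i) Ω) : SmoothCvgZero Ω ψ where
  contDiffOn i := (h.contDiffOn i).congr (hψ i)
  tendstoUniformlyOn j C hC hCΩ := by
    refine (h.tendstoUniformlyOn j C hC hCΩ).congr (Eventually.of_forall fun i z hz => ?_)
    exact (((hψ i).eventuallyEq_of_mem (hΩ.mem_nhds (hCΩ hz))).iteratedFDeriv ℝ j).eq_of_nhds.symm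

theorem zero : SmoothCvgZero Ω fun _ => (0 : F → E) where
  contDiffOn _ := contDiffOn_const
  tendstoUniformlyOn j C _ _ := SeminormedAddGroup.tendstoUniformlyOn_zero.2 fun ε hε => by
    exact Eventually.of_forall fun _ _ _ => by simpa using hε

theorem add (h : SmoothCvgZero Ω φ) (hΩ : IsOpen Ω) {ψ : ℕ → F → E} (hψ : SmoothCvgZero Ω ψ) :
    SmoothCvgZero Ω fun i => φ i + ψ i where
  contDiffOn i := (h.contDiffOn i).add (hψ.contDiffOn i)
  tendstoUniformlyOn j C hC hCΩ := by
    have hsum := (h.tendstoUniformlyOn j C hC hCΩ).add (hψ.tendstoUniformlyOn j C hC hCΩ)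
    rw [add_zero] at hsum
    refine hsum.congr (Eventually.of_forall fun i z hz => (iteratedFDeriv_add_apply ?_ ?_).symm)
    · exact ((h.contDiffOn i).contDiffAt (hΩ.mem_nhds (hCΩ hz))).of_le (by exact_mod_cast le_top)
    · exact ((hψ.contDiffOn i).contDiffAt (hΩ.mem_nhds (hCΩ hz))).of_le (by exact_mod_cast le_top)

theorem of_locally [LocallyCompactSpace F]
    (h : ∀ z ∈ Ω, ∃ O, IsOpen O ∧ z ∈ O ∧ SmoothCvgZero O φ) : SmoothCvgZero Ω φ where
  contDiffOn i z hz := by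
    obtain ⟨O, hO, hzO, hφ⟩ := h z hz
    exact ((hφ.contDiffOn i).contDiffAt (hO.mem_nhds hzO)).contDiffWithinAt
  tendstoUniformlyOn j C hC hCΩ := by
    refine (tendstoLocallyUniformlyOn_iff_tendstoUniformlyOn_of_compact hC).1
      fun u hu z hz => ?_
    obtain ⟨O, hO, hzO, hφ⟩ := h z (hCΩ hz)
    obtain ⟨D, hD, hzD, hDO⟩ := exists_compact_subset hO hzO
    exact ⟨D, mem_nhdsWithin_of_mem_nhds (mem_interior_iff_mem_nhds.1 hzD),
      hφ.tendstoUniformlyOn j D hD hDO u hu⟩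

theorem eventually_norm_lt (h : SmoothCvgZero Ω φ) (j : ℕ) {C : Set F} (hC : IsCompact C)
    (hCΩ : C ⊆ Ω) {ε : ℝ} (hε : 0 < ε) :
    ∀ᶠ i in atTop, ∀ l ≤ j, ∀ z ∈ C, ‖iteratedFDeriv ℝ l (φ i) z‖ < ε := by
  have := (eventually_all_finset (Finset.range (j + 1))).2 fun l _ =>
    SeminormedAddGroup.tendstoUniformlyOn_zero.1 (h.tendstoUniformlyOn l C hC hCΩ) ε hε
  filter_upwards [this] with i hi l hl using hi l (Finset.mem_range_succ_iff.2 hl)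

theorem mul {A : Type*} [NormedRing A] [NormedAlgebra ℝ A] {φ : ℕ → F → A}
    (h : SmoothCvgZero Ω φ) (hΩ : IsOpen Ω) {g : F → A} (hg : ContDiffOn ℝ ∞ g Ω) :
    SmoothCvgZero Ω fun i z => g z * φ i z where
  contDiffOn i := hg.mul (h.contDiffOn i)
  tendstoUniformlyOn j C hC hCΩ := SeminormedAddGroup.tendstoUniformlyOn_zero.2 fun ε hε => by
    obtain ⟨B, hB1, hB⟩ := exists_norm_iteratedFDeriv_le hΩ hg hC hCΩ j
    have hS : 0 < 2 ^ j * B := by positivity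
    filter_upwards [h.eventually_norm_lt j hC hCΩ (half_pos (div_pos hε hS))] with i hi z hz
    have hleibniz := norm_iteratedFDerivWithin_mul_le hg (h.contDiffOn i) hΩ.uniqueDiffOn
      (hCΩ hz) (n := j) (by exact_mod_cast le_top)
    simp only [iteratedFDerivWithin_of_isOpen _ hΩ (hCΩ hz)] at hleibniz
    calc _ ≤ ∑ l ∈ Finset.range (j + 1), (j.choose l : ℝ) * B * (ε / (2 ^ j * B) / 2) := by
          refine hleibniz.trans (Finset.sum_le_sum fun l hl => ?_)
          gcongr
          · exact hB l (Finset.mem_range_succ_iff.1 hl) z hz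
          · exact (hi (j - l) (Nat.sub_le _ _) z hz).le
      _ = 2 ^ j * B * (ε / (2 ^ j * B) / 2) := by
          rw [← Finset.sum_mul, ← Finset.sum_mul]
          exact_mod_cast congrArg (fun c : ℕ => (c : ℝ) * B * (ε / (2 ^ j * B) / 2))
            (Nat.sum_range_choose j)
      _ = ε / 2 := by field_simp
      _ < ε := half_lt_self hε

theorem comp (h : SmoothCvgZero Ω φ) (hΩ : IsOpen Ω) {O : Set G} (hO : IsOpen O) {ψ : G → F}
    (hψ : ContDiffOn ℝ ∞ ψ O) (hm : MapsTo ψ O Ω) : SmoothCvgZero O fun i z => φ i (ψ z) where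
  contDiffOn i := (h.contDiffOn i).comp hψ hm
  tendstoUniformlyOn j C hC hCO := SeminormedAddGroup.tendstoUniformlyOn_zero.2 fun ε hε => by
    obtain ⟨B, hB1, hB⟩ := exists_norm_iteratedFDeriv_le hO hψ hC hCO j
    have hS : 0 < j.factorial * B ^ j := by positivity
    filter_upwards [h.eventually_norm_lt j
      (hC.image_of_continuousOn (hψ.continuousOn.mono hCO))
      ((hm.mono_left hCO).image_subset) (half_pos (div_pos hε hS))] with i hi z hz
    have hfaa := norm_iteratedFDerivWithin_comp_le (h.contDiffOn i) hψ (n := j)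
      (by exact_mod_cast le_top) hΩ.uniqueDiffOn hO.uniqueDiffOn hm (hCO hz)
      (C := ε / (j.factorial * B ^ j) / 2) (D := B)
      (fun l hl => by
        rw [iteratedFDerivWithin_of_isOpen _ hΩ (hm (hCO hz))]
        exact (hi l hl _ (mem_image_of_mem ψ hz)).le)
      (fun l hl₁ hl => by
        rw [iteratedFDerivWithin_of_isOpen _ hO (hCO hz)]
        exact (hB l hl z hz).trans (le_self_pow₀ hB1 (by lia)))
    rw [iteratedFDerivWithin_of_isOpen j hO (hCO hz)] at hfaa
    calc _ ≤ j.factorial * (ε / (j.factorial * B ^ j) / 2) * B ^ j := hfaa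
      _ = ε / 2 := by field_simp
      _ < ε := half_lt_self hε

theorem partialIntegral {H : Type*} [NormedAddCommGroup H] [NormedSpace ℝ H]
    [MeasurableSpace H] [BorelSpace H] (ν : Measure H) [IsFiniteMeasureOnCompacts ν]
    {φ : ℕ → F × H → E} (h : SmoothCvgZero univ φ) {K : Set (F × H)} (hK : IsCompact K)
    (hs : ∀ i, tsupport (φ i) ⊆ K) : SmoothCvgZero univ fun i y => ∫ z, φ i (y, z) ∂ν := by
  have hsmooth (i : ℕ) : ContDiff ℝ ∞ (φ i) := contDiffOn_univ.1 (h.contDiffOn i)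
  have hcpt (i : ℕ) : HasCompactSupport (φ i) :=
    hK.of_isClosed_subset (isClosed_tsupport _) (hs i)
  refine ⟨fun i => (contDiff_partialIntegral ν (hsmooth i) (hcpt i)).contDiffOn,
    fun j C _ _ => SeminormedAddGroup.tendstoUniformlyOn_zero.2 fun ε hε => ?_⟩
  set v := ν.real (Prod.snd '' K)
  have hv : 0 ≤ v := measureReal_nonneg
  filter_upwards [h.eventually_norm_lt j hK (subset_univ _) (by positivity : 0 < ε / (v + 1))]
    with i hi z _
  have hbound (w : F × H) : ‖iteratedFDeriv ℝ j (φ i) w‖ ≤ ε / (v + 1) := by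
    by_cases hw : w ∈ K
    · exact (hi j le_rfl w hw).le
    · have : iteratedFDeriv ℝ j (φ i) w = 0 := by
        by_contra h0
        exact hw (hs i (support_iteratedFDeriv_subset j h0))
      rw [this, norm_zero]
      positivity
  calc _ ≤ ε / (v + 1) * v :=
        norm_iteratedFDeriv_partialIntegral_le ν (hsmooth i) hK (hs i) hbound z
    _ < ε / (v + 1) * (v + 1) := by gcongr; linarith
    _ = ε := by field_simp

end SmoothCvgZero

end SmoothCvg

/-! ## Fourier transform in the fibre variables -/

/-- The Fourier transform `∫ e^{-i⟨u,ξ⟩} Φ(x,u) du` in the second variable, with the normalisation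
of `symbolPairing`. -/
def fiberFourier {X : Type*} {k : ℕ} (Φ : X × Euc k → ℂ) (x : X) (ξ : Euc k) : ℂ :=
  ∫ u : Euc k, Complex.exp (-Complex.I * (inner ℝ u ξ : ℝ)) * Φ (x, u)

theorem fiberFourier_eq_fourier {X : Type*} {k : ℕ} (Φ : X × Euc k → ℂ) (x : X) (ξ : Euc k) :
    fiberFourier Φ x ξ = FourierTransform.fourier (fun u => Φ (x, u)) ((2 * Real.pi)⁻¹ • ξ) := by
  rw [Real.fourier_eq, fiberFourier]
  congr 1 with u
  rw [Circle.smul_def, smul_eq_mul, Real.fourierChar_apply, inner_smul_right]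
  congr 2
  push_cast
  have : (Real.pi : ℂ) ≠ 0 := by exact_mod_cast Real.pi_ne_zero
  field_simp

theorem fiberFourier_eq_zero {X : Type*} [TopologicalSpace X] {k : ℕ} {Φ : X × Euc k → ℂ} {x : X}
    (hx : x ∉ Prod.fst '' tsupport Φ) (ξ : Euc k) : fiberFourier Φ x ξ = 0 := by
  have h (u : Euc k) : Φ (x, u) = 0 := by
    by_contra h
    exact hx ⟨(x, u), subset_tsupport _ h, rfl⟩
  simp [fiberFourier, h]

theorem continuous_fiberFourier {X : Type*} [TopologicalSpace X] [FirstCountableTopology X]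
    [LocallyCompactSpace X] {k : ℕ} {Φ : X × Euc k → ℂ} (hΦ : Continuous Φ)
    (hc : HasCompactSupport Φ) : Continuous fun z : X × Euc k => fiberFourier Φ z.1 z.2 := by
  have h (z : X × Euc k) : fiberFourier Φ z.1 z.2 = ∫ u in Prod.snd '' tsupport Φ,
      Complex.exp (-Complex.I * (inner ℝ u z.2 : ℝ)) * Φ (z.1, u) :=
    (setIntegral_eq_integral_of_forall_compl_eq_zero fun u hu => by
      rw [image_eq_zero_of_notMem_tsupport fun hΦu => hu ⟨(z.1, u), hΦu, rfl⟩, mul_zero]).symm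
  simp only [h]
  exact continuous_parametric_integral_of_continuous (f := fun (z : X × Euc k) u =>
    Complex.exp (-Complex.I * (inner ℝ u z.2 : ℝ)) * Φ (z.1, u)) (by fun_prop)
    (hc.isCompact.image continuous_snd)

theorem exists_integral_norm_iteratedFDeriv_slice_le {F H E : Type*} [NormedAddCommGroup F]
    [NormedSpace ℝ F] [NormedAddCommGroup H] [NormedSpace ℝ H] [NormedAddCommGroup E]
    [NormedSpace ℝ E] [MeasurableSpace F] (ν : Measure F)
    [IsFiniteMeasureOnCompacts ν] {φ : F × H → E} (hφ : ContDiff ℝ ∞ φ)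
    (hc : HasCompactSupport φ) (j : ℕ) :
    ∃ C : ℝ, ∀ z, ∫ y, ‖iteratedFDeriv ℝ j (fun y => φ (y, z)) y‖ ∂ν ≤ C := by
  obtain ⟨B, hB⟩ := (hφ.continuous_iteratedFDeriv (m := j)
    (by exact_mod_cast le_top)).bounded_above_of_compact_support (hc.iteratedFDeriv j)
  have hK : IsCompact (Prod.fst '' tsupport φ) := hc.isCompact.image continuous_fst
  refine ⟨B * ν.real (Prod.fst '' tsupport φ), fun z => ?_⟩
  have hzero (y : F) (hy : y ∉ Prod.fst '' tsupport φ) :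
      ‖iteratedFDeriv ℝ j (fun y => φ (y, z)) y‖ = 0 := by
    by_contra h
    exact hy ⟨(y, z), tsupport_iteratedFDeriv_slice_subset hφ j
      (subset_tsupport _ (show iteratedFDeriv ℝ j _ _ ≠ 0 from norm_ne_zero_iff.1 h)), rfl⟩
  calc ∫ y, ‖iteratedFDeriv ℝ j (fun y => φ (y, z)) y‖ ∂ν
      = ∫ y in Prod.fst '' tsupport φ, ‖iteratedFDeriv ℝ j (fun y => φ (y, z)) y‖ ∂ν :=
        (setIntegral_eq_integral_of_forall_compl_eq_zero hzero).symm
    _ ≤ B * ν.real (Prod.fst '' tsupport φ) :=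
        (le_abs_self _).trans (norm_setIntegral_le_of_norm_le_const
          (f := fun y => ‖iteratedFDeriv ℝ j (fun y => φ (y, z)) y‖) hK.measure_lt_top fun y _ => by
            rw [norm_norm]
            exact (norm_iteratedFDeriv_slice_le hφ j y z).trans (hB _))

section Decay

variable {X : Type*} [NormedAddCommGroup X] [NormedSpace ℝ X] {k : ℕ} {Φ : X × Euc k → ℂ}

theorem exists_pow_mul_fiberFourier_le (hΦ : ContDiff ℝ ∞ Φ) (hc : HasCompactSupport Φ) (n : ℕ) :
    ∃ C : ℝ, ∀ x ξ, ‖ξ‖ ^ n * ‖fiberFourier Φ x ξ‖ ≤ C := by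
  have hswap : ContDiff ℝ ∞ fun w : Euc k × X => Φ w.swap :=
    hΦ.comp (contDiff_snd.prodMk contDiff_fst)
  have hswapc : HasCompactSupport fun w : Euc k × X => Φ w.swap :=
    hc.comp_homeomorph (Homeomorph.prodComm (Euc k) X)
  choose C hC using exists_integral_norm_iteratedFDeriv_slice_le volume hswap hswapc
  refine ⟨(2 * Real.pi) ^ n * (2 ^ n * ∑ j ∈ Finset.range (n + 1), C j), fun x ξ => ?_⟩
  have hslice : ContDiff ℝ ∞ fun u => Φ (x, u) := by fun_prop
  have hslicec : HasCompactSupport fun u => Φ (x, u) :=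
    HasCompactSupport.of_support_subset_isCompact (hc.isCompact.image continuous_snd)
      fun u hu => ⟨(x, u), subset_tsupport _ hu, rfl⟩
  have hint (i j : ℕ) : Integrable fun u => ‖u‖ ^ i * ‖iteratedFDeriv ℝ j (fun u => Φ (x, u)) u‖ :=
    ((continuous_norm.pow i).mul (hslice.continuous_iteratedFDeriv (m := j)
      (by exact_mod_cast le_top)).norm).integrable_of_hasCompactSupport
      (hslicec.iteratedFDeriv (𝕜 := ℝ) j).norm.mul_left
  have hdecay := Real.pow_mul_norm_iteratedFDeriv_fourier_le (K := ⊤) (N := ⊤) hslice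
    (fun i j _ _ => hint i j) (k := 0) (n := n) le_top le_top ((2 * Real.pi)⁻¹ • ξ)
  rw [norm_iteratedFDeriv_zero, ← fiberFourier_eq_fourier] at hdecay
  simp only [zero_add, Finset.range_one, Finset.singleton_product, Finset.sum_map,
    Function.Embedding.coeFn_mk, pow_zero, one_mul, Nat.cast_zero, mul_zero] at hdecay
  calc ‖ξ‖ ^ n * ‖fiberFourier Φ x ξ‖
      = (2 * Real.pi) ^ n * (‖(2 * Real.pi)⁻¹ • ξ‖ ^ n * ‖fiberFourier Φ x ξ‖) := by
        have hpi : 0 < 2 * Real.pi := by positivity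
        rw [norm_smul, Real.norm_of_nonneg (inv_pos.2 hpi).le, mul_pow ((2 * Real.pi)⁻¹), inv_pow,
          mul_assoc, mul_inv_cancel_left₀ (pow_pos hpi n).ne']
    _ ≤ (2 * Real.pi) ^ n * (2 ^ n * ∑ j ∈ Finset.range (n + 1), C j) := by
        refine mul_le_mul_of_nonneg_left (hdecay.trans ?_) (by positivity)
        gcongr with j
        exact hC j x

theorem exists_one_add_pow_mul_fiberFourier_le (hΦ : ContDiff ℝ ∞ Φ) (hc : HasCompactSupport Φ)
    (n : ℕ) : ∃ C : ℝ, 0 ≤ C ∧ ∀ x ξ, (1 + ‖ξ‖) ^ n * ‖fiberFourier Φ x ξ‖ ≤ C := by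
  obtain ⟨C₀, h₀⟩ := exists_pow_mul_fiberFourier_le hΦ hc 0
  obtain ⟨C₁, h₁⟩ := exists_pow_mul_fiberFourier_le hΦ hc n
  refine ⟨2 ^ (n - 1) * (|C₀| + |C₁|), by positivity, fun x ξ => ?_⟩
  calc (1 + ‖ξ‖) ^ n * ‖fiberFourier Φ x ξ‖
      ≤ 2 ^ (n - 1) * (1 ^ n + ‖ξ‖ ^ n) * ‖fiberFourier Φ x ξ‖ := by
        gcongr
        exact add_pow_le zero_le_one (norm_nonneg ξ) n
    _ = 2 ^ (n - 1) * (‖ξ‖ ^ 0 * ‖fiberFourier Φ x ξ‖ + ‖ξ‖ ^ n * ‖fiberFourier Φ x ξ‖) := by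
        ring
    _ ≤ 2 ^ (n - 1) * (|C₀| + |C₁|) := by
        gcongr
        · exact (h₀ x ξ).trans (le_abs_self _)
        · exact (h₁ x ξ).trans (le_abs_self _)

end Decay

/-! ## Oscillatory integrals -/

/-- Amplitudes of at most polynomial growth in `ξ`, locally uniformly in `x`: those for which the
iterated integrals in `symbolPairing` converge absolutely. -/
structure HasPolynomialGrowth {X : Type*} [TopologicalSpace X] {k : ℕ} (a : X → Euc k → ℂ) :
    Prop where
  continuous : Continuous fun z : X × Euc k => a z.1 z.2
  exists_norm_le : ∀ K : Set X, IsCompact K →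
    ∃ (n : ℕ) (C : ℝ), ∀ x ∈ K, ∀ ξ, ‖a x ξ‖ ≤ C * (1 + ‖ξ‖) ^ n

theorem HasPolynomialGrowth.comp {X Y : Type*} [TopologicalSpace X] [TopologicalSpace Y] {k : ℕ}
    {a : X → Euc k → ℂ} (ha : HasPolynomialGrowth a) {g : Y → X} (hg : Continuous g) :
    HasPolynomialGrowth fun y => a (g y) where
  continuous := ha.continuous.comp (by fun_prop : Continuous fun z : Y × Euc k => (g z.1, z.2))
  exists_norm_le K hK := by
    obtain ⟨n, C, hC⟩ := ha.exists_norm_le (g '' K) (hK.image hg)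
    exact ⟨n, C, fun y hy => hC (g y) (mem_image_of_mem g hy)⟩

theorem exists_norm_mul_fiberFourier_le {X : Type*} [NormedAddCommGroup X] [NormedSpace ℝ X] {k : ℕ}
    {a : X → Euc k → ℂ} (ha : HasPolynomialGrowth a) {Φ : X × Euc k → ℂ} (hΦ : ContDiff ℝ ∞ Φ)
    (hc : HasCompactSupport Φ) (N : ℕ) :
    ∃ D : ℝ, ∀ x ∈ Prod.fst '' tsupport Φ, ∀ ξ,
      ‖a x ξ * fiberFourier Φ x ξ‖ ≤ D * (1 + ‖ξ‖) ^ (-(N : ℝ)) := by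
  obtain ⟨n, C₁, hC₁⟩ :=
    ha.exists_norm_le (Prod.fst '' tsupport Φ) (hc.isCompact.image continuous_fst)
  obtain ⟨C₂, -, hC₂⟩ := exists_one_add_pow_mul_fiberFourier_le hΦ hc (n + N)
  refine ⟨|C₁| * C₂, fun x hx ξ => ?_⟩
  have hξ : 0 < 1 + ‖ξ‖ := by positivity
  rw [Real.rpow_neg hξ.le, Real.rpow_natCast, ← div_eq_mul_inv, le_div_iff₀ (by positivity),
    norm_mul]
  calc ‖a x ξ‖ * ‖fiberFourier Φ x ξ‖ * (1 + ‖ξ‖) ^ N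
      ≤ |C₁| * (1 + ‖ξ‖) ^ n * ‖fiberFourier Φ x ξ‖ * (1 + ‖ξ‖) ^ N := by
        gcongr
        exact (hC₁ x hx ξ).trans (by gcongr; exact le_abs_self _)
    _ = |C₁| * ((1 + ‖ξ‖) ^ (n + N) * ‖fiberFourier Φ x ξ‖) := by ring
    _ ≤ |C₁| * C₂ := by gcongr; exact hC₂ x ξ

theorem integrable_mul_fiberFourier {X : Type*} [NormedAddCommGroup X] [NormedSpace ℝ X]
    [FiniteDimensional ℝ X] [MeasurableSpace X] [BorelSpace X] (ν : Measure X)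
    [IsFiniteMeasureOnCompacts ν] {k : ℕ} {a : X → Euc k → ℂ}
    (ha : HasPolynomialGrowth a) {Φ : X × Euc k → ℂ} (hΦ : ContDiff ℝ ∞ Φ)
    (hc : HasCompactSupport Φ) :
    Integrable (fun w : X × Euc k => a w.1 w.2 * fiberFourier Φ w.1 w.2) (ν.prod volume) := by
  obtain ⟨D, hD⟩ := exists_norm_mul_fiberFourier_le ha hΦ hc (k + 1)
  have hK : IsCompact (Prod.fst '' tsupport Φ) := hc.isCompact.image continuous_fst
  have hX : Integrable ((Prod.fst '' tsupport Φ).indicator fun _ => D) ν :=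
    (integrable_indicator_iff hK.measurableSet).2 (integrableOn_const hK.measure_lt_top.ne)
  have hξ : Integrable fun ξ : Euc k => (1 + ‖ξ‖) ^ (-((k + 1 : ℕ) : ℝ)) :=
    integrable_one_add_norm (by simp)
  refine (hX.mul_prod hξ).mono' (ha.continuous.mul
    (continuous_fiberFourier hΦ.continuous hc)).aestronglyMeasurable (Eventually.of_forall ?_)
  rintro ⟨x, ξ⟩
  by_cases hx : x ∈ Prod.fst '' tsupport Φ
  · simpa only [indicator_of_mem hx] using hD x hx ξ
  · simp [hx, fiberFourier_eq_zero hx]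

theorem fiberFourier_partialIntegral {X H : Type*} [TopologicalSpace X] [TopologicalSpace H]
    [R1Space H] [SecondCountableTopology H] [MeasurableSpace H] [BorelSpace H] (ν : Measure H)
    [IsFiniteMeasureOnCompacts ν] [SFinite ν] {k : ℕ} {Φ : (X × H) × Euc k → ℂ}
    (hΦ : Continuous Φ) (hc : HasCompactSupport Φ) (x : X) (ξ : Euc k) :
    fiberFourier (fun z : X × Euc k => ∫ h, Φ ((z.1, h), z.2) ∂ν) x ξ =
      ∫ h, fiberFourier Φ (x, h) ξ ∂ν := by
  simp only [fiberFourier, ← integral_const_mul]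
  refine integral_integral_swap (f := fun (u : Euc k) (h : H) =>
    Complex.exp (-Complex.I * (inner ℝ u ξ : ℝ)) * Φ ((x, h), u))
    (Continuous.integrable_of_hasCompactSupport (by fun_prop) ?_)
  refine HasCompactSupport.of_support_subset_isCompact
    (hc.isCompact.image (f := fun w => (w.2, w.1.2)) (by fun_prop)) fun w hw => ?_
  exact ⟨((x, w.2), w.1), subset_tsupport _ (right_ne_zero_of_mul hw), rfl⟩

theorem integral_mul_fiberFourier_partialIntegral {X H : Type*} [NormedAddCommGroup X]
    [NormedSpace ℝ X] [FiniteDimensional ℝ X] [MeasurableSpace X] [BorelSpace X]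
    [NormedAddCommGroup H] [NormedSpace ℝ H] [FiniteDimensional ℝ H] [MeasurableSpace H]
    [BorelSpace H] (μ : Measure X) [IsFiniteMeasureOnCompacts μ] (ν : Measure H)
    [IsFiniteMeasureOnCompacts ν] {k : ℕ} {a : X → Euc k → ℂ}
    {Φ : (X × H) × Euc k → ℂ} (ha : HasPolynomialGrowth a) (hΦ : ContDiff ℝ ∞ Φ)
    (hc : HasCompactSupport Φ) :
    ∫ x, (∫ ξ, a x ξ * fiberFourier (fun z : X × Euc k => ∫ h, Φ ((z.1, h), z.2) ∂ν) x ξ) ∂μ =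
      ∫ w, (∫ ξ, a w.1 ξ * fiberFourier Φ w ξ) ∂μ.prod ν := by
  rw [integral_prod _ (integrable_mul_fiberFourier (μ.prod ν) (ha.comp continuous_fst) hΦ
    hc).integral_prod_left]
  congr 1 with x
  have hslice : ContDiff ℝ ∞ fun w : H × Euc k => Φ ((x, w.1), w.2) := by fun_prop
  have hslicec : HasCompactSupport fun w : H × Euc k => Φ ((x, w.1), w.2) :=
    HasCompactSupport.of_support_subset_isCompact
      (hc.isCompact.image (f := fun w => (w.1.2, w.2)) (by fun_prop))
      fun w hw => ⟨((x, w.1), w.2), subset_tsupport _ hw, rfl⟩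
  rw [integral_integral_swap (integrable_mul_fiberFourier ν
    (a := fun _ => a x) (ha.comp continuous_const) hslice hslicec)]
  congr 1 with ξ
  rw [fiberFourier_partialIntegral ν hΦ.continuous hc, ← integral_const_mul]

theorem symbolPairing_partialIntegral {d d' k : ℕ} {H : Type*} [NormedAddCommGroup H]
    [NormedSpace ℝ H] [FiniteDimensional ℝ H] [MeasurableSpace H] [BorelSpace H] (ν : Measure H)
    [IsFiniteMeasureOnCompacts ν] (S : (Euc d × H) ≃L[ℝ] Euc d')
    (hS : MeasurePreserving S (volume.prod ν) volume) {a : Euc d → Euc k → ℂ}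
    (ha : HasPolynomialGrowth a) {Φ : Euc d' × Euc k → ℂ} (hΦ : ContDiff ℝ ∞ Φ)
    (hc : HasCompactSupport Φ) :
    symbolPairing a (fun z => ∫ h, Φ (S (z.1, h), z.2) ∂ν) =
      symbolPairing (fun x' => a (S.symm x').1) Φ := by
  have hcS : HasCompactSupport fun w : (Euc d × H) × Euc k => Φ (S w.1, w.2) :=
    hc.comp_homeomorph (S.toHomeomorph.prodCongr (Homeomorph.refl _))
  have h := integral_mul_fiberFourier_partialIntegral volume ν ha
    (by fun_prop : ContDiff ℝ ∞ fun w : (Euc d × H) × Euc k => Φ (S w.1, w.2)) hcS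
  refine congrArg _ (h.trans ?_)
  rw [← hS.integral_comp S.toHomeomorph.measurableEmbedding]
  simp [fiberFourier]

/-! ## Classical symbols -/

theorem IsClassicalSymbol.hasPolynomialGrowth {d k : ℕ} {m : ℂ} {a : Euc d → Euc k → ℂ}
    {A : ℕ → Euc d → Euc k → ℂ} (h : IsClassicalSymbol m a A) : HasPolynomialGrowth a where
  continuous := h.smooth.continuous
  exists_norm_le K hK := by
    obtain ⟨C₁, hC₁⟩ := h.asymptotic 0 0 0 K hK
    obtain ⟨C₂, hC₂⟩ := (hK.prod (isCompact_closedBall (0 : Euc k) 1)).exists_bound_of_continuousOn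
      h.smooth.continuous.continuousOn
    obtain ⟨n, hn⟩ := exists_nat_ge m.re
    refine ⟨n, |C₁| + |C₂|, fun x hx ξ => ?_⟩
    rcases le_total 1 ‖ξ‖ with hξ | hξ
    · have hlarge : ‖a x ξ‖ ≤ C₁ * ‖ξ‖ ^ m.re := by simpa using hC₁ x hx ξ hξ
      calc ‖a x ξ‖ ≤ |C₁| * ‖ξ‖ ^ (n : ℝ) := hlarge.trans (by gcongr; exact le_abs_self _)
        _ = |C₁| * ‖ξ‖ ^ n := by rw [Real.rpow_natCast]
        _ ≤ (|C₁| + |C₂|) * (1 + ‖ξ‖) ^ n := by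
          gcongr
          · exact le_add_of_nonneg_right (abs_nonneg _)
          · exact le_add_of_nonneg_left zero_le_one
    · calc ‖a x ξ‖ ≤ |C₂| := (hC₂ (x, ξ) ⟨hx, by simpa using hξ⟩).trans (le_abs_self _)
        _ ≤ |C₁| + |C₂| := le_add_of_nonneg_left (abs_nonneg _)
        _ ≤ (|C₁| + |C₂|) * (1 + ‖ξ‖) ^ n := le_mul_of_one_le_right (by positivity)
          (one_le_pow₀ (le_add_of_nonneg_right (norm_nonneg ξ)))

section Derivatives

variable {X Y E : Type*} [NormedAddCommGroup X] [NormedSpace ℝ X]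
  [NormedAddCommGroup Y] [NormedSpace ℝ Y] [NormedAddCommGroup E] [NormedSpace ℝ E]

theorem contDiffAt_iteratedFDeriv_snd {r : X → Y → E} {z : X × Y}
    (hr : ContDiffAt ℝ ∞ (Function.uncurry r) z) (l : ℕ) :
    ContDiffAt ℝ ∞ (fun z : X × Y => iteratedFDeriv ℝ l (r z.1) z.2) z := by
  induction l with
  | zero =>
    exact ((continuousMultilinearCurryFin0 ℝ Y E).symm.contDiff (n := ∞)).contDiffAt.comp z hr
  | succ l ih =>
    have hfderiv : ContDiffAt ℝ ∞ (fun w : X × Y => fderiv ℝ (iteratedFDeriv ℝ l (r w.1)) w.2) z :=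
      ContDiffAt.fderiv (n := ∞) (f := fun w : X × Y => iteratedFDeriv ℝ l (r w.1)) (g := Prod.snd)
        (ih.comp (f := fun q : (X × Y) × Y => (q.1.1, q.2)) (z, z.2) (by fun_prop))
        contDiffAt_snd (by simp)
    simp only [iteratedFDeriv_succ_eq_comp_left]
    exact ((continuousMultilinearCurryLeftEquiv ℝ (fun _ : Fin (l + 1) => Y) E).symm.contDiff
      (n := ∞)).contDiffAt.comp z hfderiv

theorem norm_iteratedFDeriv_comp_clm_le {g : Y → E} (hg : ContDiff ℝ ∞ g) (π : X →L[ℝ] Y) (i : ℕ)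
    (x : X) :
    ‖iteratedFDeriv ℝ i (fun x => g (π x)) x‖ ≤ ‖iteratedFDeriv ℝ i g (π x)‖ * ‖π‖ ^ i := by
  have h := π.iteratedFDeriv_comp_right hg x (i := i) (by exact_mod_cast le_top)
  simp only [Function.comp_def] at h
  rw [h]
  simpa using ContinuousMultilinearMap.norm_compContinuousLinearMap_le
    (iteratedFDeriv ℝ i g (π x)) fun _ : Fin i => π

end Derivatives

namespace IsClassicalSymbol

variable {d d' k : ℕ} {m : ℂ} {a : Euc d → Euc k → ℂ} {A : ℕ → Euc d → Euc k → ℂ}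

theorem contDiff_iteratedFDeriv_remainder (h : IsClassicalSymbol m a A) (N l : ℕ) {ξ : Euc k}
    (hξ : ξ ≠ 0) : ContDiff ℝ ∞ fun x =>
      iteratedFDeriv ℝ l (fun ξ' => a x ξ' - ∑ j ∈ Finset.range N, A j x ξ') ξ := by
  refine contDiff_iff_contDiffAt.2 fun x => ?_
  have hopen : IsOpen {z : Euc d × Euc k | z.2 ≠ 0} := isOpen_ne_fun continuous_snd continuous_const
  have hremainder : ContDiffAt ℝ ∞
      (Function.uncurry fun x ξ' => a x ξ' - ∑ j ∈ Finset.range N, A j x ξ') (x, ξ) :=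
    h.smooth.contDiffAt.sub (ContDiffAt.sum fun j _ =>
      (h.smooth_term j).contDiffAt (hopen.mem_nhds hξ))
  exact (contDiffAt_iteratedFDeriv_snd hremainder l).comp x
    (by fun_prop : ContDiffAt ℝ ∞ (fun x : Euc d => (x, ξ)) x)

theorem comp_clm (h : IsClassicalSymbol m a A) (π : Euc d' →L[ℝ] Euc d) :
    IsClassicalSymbol m (fun x' => a (π x')) (fun j x' => A j (π x')) where
  smooth := h.smooth.comp
    (by fun_prop : ContDiff ℝ ∞ fun z : Euc d' × Euc k => (π z.1, z.2))
  smooth_term j := (h.smooth_term j).comp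
    (by fun_prop : ContDiff ℝ ∞ fun z : Euc d' × Euc k => (π z.1, z.2)).contDiffOn fun _ hz => hz
  homogeneous j x := h.homogeneous j (π x)
  asymptotic N i l K hK := by
    obtain ⟨C, hC⟩ := h.asymptotic N i l (π '' K) (hK.image π.continuous)
    refine ⟨C * ‖π‖ ^ i, fun x hx ξ hξ => ?_⟩
    have hξ0 : ξ ≠ 0 := norm_ne_zero_iff.1 (by linarith)
    refine (norm_iteratedFDeriv_comp_clm_le
      (h.contDiff_iteratedFDeriv_remainder N l hξ0) π i x).trans ?_
    rw [mul_right_comm]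
    gcongr
    exact hC (π x) (mem_image_of_mem π hx) ξ hξ

end IsClassicalSymbol

/-! ## Smooth charts -/

theorem tsupport_indicator_subset {X E : Type*} [TopologicalSpace X] [Zero E] {Ω K : Set X}
    (hK : IsClosed K) {φ : X → E} (h0 : ∀ z ∈ Ω, z ∉ K → φ z = 0) :
    tsupport (Ω.indicator φ) ⊆ K :=
  closure_minimal (fun z hz => by_contra fun hzK =>
    (indicator_apply_ne_zero.1 hz).2 (h0 z (indicator_apply_ne_zero.1 hz).1 hzK)) hK

theorem contMDiff_indicator {E₀ H E M : Type*} [NormedAddCommGroup E₀] [NormedSpace ℝ E₀]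
    [TopologicalSpace H] {I : ModelWithCorners ℝ E₀ H} [NormedAddCommGroup E] [NormedSpace ℝ E]
    [TopologicalSpace M] [ChartedSpace H M] {Ω K : Set M} (hΩ : IsOpen Ω) (hK : IsClosed K)
    (hKΩ : K ⊆ Ω) {φ : M → E} (hφ : ContMDiffOn I 𝓘(ℝ, E) ∞ φ Ω)
    (h0 : ∀ z ∈ Ω, z ∉ K → φ z = 0) : ContMDiff I 𝓘(ℝ, E) ∞ (Ω.indicator φ) :=
  contMDiff_of_tsupport fun _ hx =>
    have hxΩ := hΩ.mem_nhds (hKΩ (tsupport_indicator_subset hK h0 hx))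
    (hφ.contMDiffAt hxΩ).congr_of_eventuallyEq (eqOn_indicator.eventuallyEq_of_mem hxΩ)

section Charts

variable {n : ℕ} {M : Type*} [TopologicalSpace M] [ChartedSpace (Euc n) M]
  {F F₁ E : Type*} [NormedAddCommGroup F] [NormedSpace ℝ F]
  [NormedAddCommGroup F₁] [NormedSpace ℝ F₁] [NormedAddCommGroup E] [NormedSpace ℝ E]

theorem contDiff_indicator {Ω K : Set F} (hΩ : IsOpen Ω) (hK : IsClosed K) (hKΩ : K ⊆ Ω)
    {φ : F → E} (hφ : ContDiffOn ℝ ∞ φ Ω) (h0 : ∀ z ∈ Ω, z ∉ K → φ z = 0) :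
    ContDiff ℝ ∞ (Ω.indicator φ) :=
  contMDiff_iff_contDiff.1
    (contMDiff_indicator hΩ hK hKΩ (contMDiffOn_iff_contDiffOn.2 hφ) h0)

theorem isSmoothChart_of_mem_maximalAtlas {e : OpenPartialHomeomorph M (Euc n)}
    (he : e ∈ IsManifold.maximalAtlas (𝓡 n) ∞ M) : IsSmoothChart n e :=
  ⟨contMDiffOn_of_mem_maximalAtlas he, contMDiffOn_symm_of_mem_maximalAtlas he⟩

theorem isSmoothChart_chartAt [IsManifold (𝓡 n) ∞ M] (x : M) :
    IsSmoothChart n (chartAt (Euc n) x) :=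
  isSmoothChart_of_mem_maximalAtlas (IsManifold.chart_mem_maximalAtlas x)

namespace IsSmoothChart

variable {e : OpenPartialHomeomorph M F} {e₁ : OpenPartialHomeomorph M F₁}

theorem mdifferentiable (he : IsSmoothChart n e) : e.MDifferentiable (𝓡 n) 𝓘(ℝ, F) :=
  ⟨he.contMDiffOn.mdifferentiableOn (by simp), he.contMDiffOn_symm.mdifferentiableOn (by simp)⟩

theorem restrOpen (he : IsSmoothChart n e) {s : Set M} (hs : IsOpen s) :
    IsSmoothChart n (e.restrOpen s hs) :=
  ⟨he.contMDiffOn.mono inter_subset_left, he.contMDiffOn_symm.mono inter_subset_left⟩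

theorem trans (he : IsSmoothChart n e) {ψ : OpenPartialHomeomorph F F₁}
    (h : ContDiffOn ℝ ∞ ψ ψ.source) (h' : ContDiffOn ℝ ∞ ψ.symm ψ.target) :
    IsSmoothChart n (e.trans ψ) where
  contMDiffOn := (contMDiffOn_iff_contDiffOn.2 h).comp
    (he.contMDiffOn.mono inter_subset_left) fun _ hy => hy.2
  contMDiffOn_symm := he.contMDiffOn_symm.comp
    ((contMDiffOn_iff_contDiffOn.2 h').mono inter_subset_left) fun _ hz => hz.2

theorem transHomeomorph (he : IsSmoothChart n e) (L : F ≃L[ℝ] F₁) :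
    IsSmoothChart n (e.transHomeomorph L.toHomeomorph) where
  contMDiffOn := L.contDiff.contMDiff.comp_contMDiffOn he.contMDiffOn
  contMDiffOn_symm := he.contMDiffOn_symm.comp L.symm.contDiff.contMDiff.contMDiffOn fun _ hz => hz

theorem comp_contDiffOn (he : IsSmoothChart n e) {f : M → E} {s : Set M}
    (hf : ContMDiffOn (𝓡 n) 𝓘(ℝ, E) ∞ f s) :
    ContDiffOn ℝ ∞ (f ∘ e.symm) (e.target ∩ e.symm ⁻¹' s) :=
  contMDiffOn_iff_contDiffOn.1
    (hf.comp (he.contMDiffOn_symm.mono inter_subset_left) fun _ hz => hz.2)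

theorem contDiffOn_comp_symm (he : IsSmoothChart n e) (he₁ : IsSmoothChart n e₁) :
    ContDiffOn ℝ ∞ (e₁ ∘ e.symm) (e.target ∩ e.symm ⁻¹' e₁.source) :=
  he.comp_contDiffOn he₁.contMDiffOn

theorem det_fderiv_comp_symm_ne_zero {c : OpenPartialHomeomorph M F} (he : IsSmoothChart n e)
    (hc : IsSmoothChart n c) {z : F} (hz : z ∈ e.target ∩ e.symm ⁻¹' c.source) :
    (fderiv ℝ (c ∘ e.symm) z).det ≠ 0 := by
  have h : (e.symm.trans c).MDifferentiable 𝓘(ℝ, F) 𝓘(ℝ, F) :=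
    ⟨((he.contDiffOn_comp_symm hc).differentiableOn (by simp)).mdifferentiableOn,
      ((hc.contDiffOn_comp_symm he).differentiableOn (by simp)).mdifferentiableOn⟩
  rw [← mfderiv_eq_fderiv]
  exact (LinearEquiv.isUnit_det' (h.mfderiv hz).toLinearEquiv).ne_zero

theorem exists_testFunction [T2Space M] (he : IsSmoothChart n e) {φ : F → ℂ}
    (hφ : ContDiffOn ℝ ∞ φ e.target) {K : Set F} (hK : IsCompact K) (hKe : K ⊆ e.target)
    (h0 : ∀ z ∈ e.target, z ∉ K → φ z = 0) :
    ∃ g : testFunctions n M, tsupport (g : M → ℂ) ⊆ e.symm '' K ∧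
      (g : M → ℂ) = e.source.indicator (φ ∘ e) := by
  have hK' : IsCompact (e.symm '' K) := hK.image_of_continuousOn (e.continuousOn_symm.mono hKe)
  have h0' : ∀ y ∈ e.source, y ∉ e.symm '' K → (φ ∘ e) y = 0 := fun y hy hyK =>
    h0 _ (e.map_source hy) fun h => hyK ⟨e y, h, e.left_inv hy⟩
  have hs := tsupport_indicator_subset hK'.isClosed h0'
  refine ⟨⟨_, contMDiff_indicator e.open_source hK'.isClosed ?_ ?_ h0', ?_⟩, hs, rfl⟩
  · exact image_subset_iff.2 fun z hz => e.map_target (hKe hz)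
  · exact (contMDiffOn_iff_contDiffOn.2 hφ).comp he.contMDiffOn e.mapsTo
  · exact hK'.of_isClosed_subset (isClosed_tsupport _) hs

end IsSmoothChart

end Charts

/-! ## Smooth densities in charts -/

instance volume_prod_isAddHaar {E F : Type*} [NormedAddCommGroup E] [MeasureSpace E]
    [BorelSpace E] [NormedAddCommGroup F] [MeasureSpace F] [BorelSpace F]
    [(volume : Measure E).IsAddHaarMeasure] [(volume : Measure F).IsAddHaarMeasure]
    [SFinite (volume : Measure E)] [SFinite (volume : Measure F)] :
    (volume : Measure (E × F)).IsAddHaarMeasure :=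
  inferInstanceAs ((volume : Measure E).prod (volume : Measure F)).IsAddHaarMeasure

theorem contDiff_det {F : Type*} [NormedAddCommGroup F] [NormedSpace ℝ F]
    [FiniteDimensional ℝ F] : ContDiff ℝ ∞ fun A : F →L[ℝ] F => A.det := by
  classical
  let b := Module.finBasis ℝ F
  have hdet (A : F →L[ℝ] F) :
      A.det = ∑ σ : Equiv.Perm (Fin _), (σ.sign : ℝ) * ∏ i, b.coord (σ i) (A (b i)) := by
    rw [ContinuousLinearMap.det, ← LinearMap.det_toMatrix b, Matrix.det_apply']
    simp [LinearMap.toMatrix_apply]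
  simp only [hdet]
  refine ContDiff.sum fun σ _ => contDiff_const.mul (contDiff_prod fun i _ => ?_)
  exact (b.coord (σ i)).toContinuousLinearMap.contDiff.comp
    (ContinuousLinearMap.apply ℝ F (b i)).contDiff

namespace HasDensityInChart

variable {M : Type*} [TopologicalSpace M] [MeasurableSpace M] [BorelSpace M]
  {F : Type*} [NormedAddCommGroup F] [NormedSpace ℝ F] [MeasureSpace F] [BorelSpace F]
  {μ : Measure M} {e : OpenPartialHomeomorph M F} {w : F → ℝ}

theorem measure_image_symm (h : HasDensityInChart μ e w) {S : Set F} (hS : MeasurableSet S)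
    (hSe : S ⊆ e.target) : μ (e.symm '' S) = ∫⁻ z in S, ENNReal.ofReal (w z) := by
  have := congrArg (fun m => m S) h.map_eq
  rwa [Measure.map_apply_of_aemeasurable
      (e.continuousOn.aemeasurable e.open_source.measurableSet) hS,
    Measure.restrict_apply' e.open_source.measurableSet, withDensity_apply _ hS,
    Measure.restrict_restrict hS, inter_eq_left.2 hSe, inter_comm,
    ← e.symm_image_eq_source_inter_preimage hSe] at this

theorem of_measure_image_symm (hw : ContDiffOn ℝ ∞ w e.target) (hpos : ∀ z ∈ e.target, 0 < w z)
    (h : ∀ S, MeasurableSet S → S ⊆ e.target →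
      μ (e.symm '' S) = ∫⁻ z in S, ENNReal.ofReal (w z)) : HasDensityInChart μ e w where
  contDiffOn := hw
  pos := hpos
  map_eq := by
    ext S hS
    rw [Measure.map_apply_of_aemeasurable
        (e.continuousOn.aemeasurable e.open_source.measurableSet) hS,
      Measure.restrict_apply' e.open_source.measurableSet, withDensity_apply _ hS,
      Measure.restrict_restrict hS,
      ← h _ (hS.inter e.open_target.measurableSet) inter_subset_right, inter_comm, inter_comm S]
    exact congrArg μ (e.symm.image_source_inter_eq' S).symm

theorem restrOpen (h : HasDensityInChart μ e w) {s : Set M} (hs : IsOpen s) :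
    HasDensityInChart μ (e.restrOpen s hs) w :=
  of_measure_image_symm (h.contDiffOn.mono inter_subset_left) (fun z hz => h.pos z hz.1)
    fun _ hS hSe => h.measure_image_symm hS (hSe.trans inter_subset_left)

theorem transHomeomorph {G : Type*} [NormedAddCommGroup G] [NormedSpace ℝ G] [MeasureSpace G]
    [BorelSpace G] (h : HasDensityInChart μ e w) (L : G ≃L[ℝ] F) {β : NNReal} (hβ : 0 < β)
    (hL : (volume : Measure F) = β • Measure.map L volume) :
    HasDensityInChart μ (e.transHomeomorph L.symm.toHomeomorph) fun z => β * w (L z) := by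
  have hLm : MeasurableEmbedding L := L.toHomeomorph.measurableEmbedding
  refine of_measure_image_symm (contDiffOn_const.mul
    (h.contDiffOn.comp L.contDiff.contDiffOn fun _ hz => hz))
    (fun z hz => mul_pos (NNReal.coe_pos.2 hβ) (h.pos _ hz)) fun S hS hSe => ?_
  have himg : (e.transHomeomorph L.symm.toHomeomorph).symm '' S = e.symm '' (L '' S) :=
    image_comp e.symm L S
  rw [himg, h.measure_image_symm (hLm.measurableSet_image.2 hS) (image_subset_iff.2 hSe), hL,
    Measure.restrict_smul, lintegral_smul_measure, hLm.restrict_map, hLm.lintegral_map,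
    preimage_image_eq _ L.injective]
  simp only [ENNReal.ofReal_mul β.coe_nonneg, ENNReal.ofReal_coe_nnreal]
  rw [lintegral_const_mul' _ _ ENNReal.coe_ne_top]
  rfl

theorem change_chart {n : ℕ} [ChartedSpace (Euc n) M] [FiniteDimensional ℝ F]
    [(volume : Measure F).IsAddHaarMeasure] {c : OpenPartialHomeomorph M F}
    (h : HasDensityInChart μ c w) (hc : IsSmoothChart n c) (he : IsSmoothChart n e)
    (hec : e.source ⊆ c.source) :
    HasDensityInChart μ e fun z => |(fderiv ℝ (c ∘ e.symm) z).det| * w (c (e.symm z)) := by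
  have hmaps : MapsTo e.symm e.target c.source := fun z hz => hec (e.map_target hz)
  have hT : ContDiffOn ℝ ∞ (c ∘ e.symm) e.target :=
    (he.contDiffOn_comp_symm hc).mono fun z hz => ⟨hz, hmaps hz⟩
  have hTd : ∀ z ∈ e.target, HasFDerivAt (c ∘ e.symm) (fderiv ℝ (c ∘ e.symm) z) z := fun z hz =>
    ((hT.contDiffAt (e.open_target.mem_nhds hz)).differentiableAt (by simp)).hasFDerivAt
  have hinj : InjOn (c ∘ e.symm) e.target := c.injOn.comp e.symm.injOn hmaps
  have hdet : ∀ z ∈ e.target, (fderiv ℝ (c ∘ e.symm) z).det ≠ 0 := fun z hz =>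
    he.det_fderiv_comp_symm_ne_zero hc ⟨hz, hmaps hz⟩
  refine of_measure_image_symm ?_ ?_ fun S hS hSe => ?_
  · have hdetT : ContDiffOn ℝ ∞ (fun z => (fderiv ℝ (c ∘ e.symm) z).det) e.target :=
      contDiff_det.comp_contDiffOn (hT.fderiv_of_isOpen e.open_target (by simp))
    refine ContDiffOn.mul (fun z hz => ?_) (h.contDiffOn.comp hT fun z hz =>
      c.map_source (hmaps hz))
    exact (contDiffAt_abs (hdet z hz)).comp_contDiffWithinAt z (hdetT z hz)
  · exact fun z hz => mul_pos (abs_pos.2 (hdet z hz)) (h.pos _ (c.map_source (hmaps hz)))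
  · have himg : e.symm '' S = c.symm '' ((c ∘ e.symm) '' S) := by
      rw [← image_comp]
      exact image_congr fun z hz => (c.left_inv (hmaps (hSe hz))).symm
    rw [himg, h.measure_image_symm
        (hS.image_of_continuousOn_injOn (hT.continuousOn.mono hSe) (hinj.mono hSe))
        (image_subset_iff.2 fun z hz => c.map_source (hmaps (hSe hz))),
      lintegral_image_eq_lintegral_abs_det_fderiv_mul volume hS
        (fun z hz => (hTd z (hSe hz)).hasFDerivWithinAt) (hinj.mono hSe)]
    simp only [ENNReal.ofReal_mul (abs_nonneg _), Function.comp_apply]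

theorem integral_eq (h : HasDensityInChart μ e w) {φ : M → ℂ}
    (hφ : ContinuousOn φ e.source) (h0 : ∀ y ∉ e.source, φ y = 0) :
    ∫ y, φ y ∂μ = ∫ z in e.target, (w z : ℂ) * φ (e.symm z) := by
  have he := e.continuousOn.aemeasurable (μ := μ) e.open_source.measurableSet
  have hw : AEMeasurable (fun z => ENNReal.ofReal (w z)) (volume.restrict e.target) :=
    (h.contDiffOn.continuousOn.aemeasurable e.open_target.measurableSet).ennreal_ofReal
  have hc : AEStronglyMeasurable (fun z => φ (e.symm z)) (Measure.map e (μ.restrict e.source)) := by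
    rw [h.map_eq]
    exact ((hφ.comp e.continuousOn_symm e.mapsTo_symm).aestronglyMeasurable
      e.open_target.measurableSet).mono_ac (withDensity_absolutelyContinuous _ _)
  calc ∫ y, φ y ∂μ = ∫ y in e.source, φ (e.symm (e y)) ∂μ := by
        rw [← setIntegral_eq_integral_of_forall_compl_eq_zero h0]
        exact setIntegral_congr_fun e.open_source.measurableSet fun y hy => by
          simp only [e.left_inv hy]
    _ = ∫ z in e.target, (ENNReal.ofReal (w z)).toReal • φ (e.symm z) := by
        rw [← integral_map he hc, h.map_eq, integral_withDensity_eq_integral_toReal_smul₀ hw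
          (Eventually.of_forall fun _ => ENNReal.ofReal_lt_top)]
    _ = ∫ z in e.target, (w z : ℂ) * φ (e.symm z) :=
        setIntegral_congr_fun e.open_target.measurableSet fun z hz => by
          simp only [ENNReal.toReal_ofReal (h.pos z hz).le, Complex.real_smul]

theorem exists_mem_nhds_measure_lt_top [LocallyCompactSpace F]
    [IsFiniteMeasureOnCompacts (volume : Measure F)] (h : HasDensityInChart μ e w) {x : M}
    (hx : x ∈ e.source) : ∃ s ∈ 𝓝 x, μ s < ⊤ := by
  obtain ⟨B, hB, hxB, hBt⟩ := exists_compact_subset e.open_target (e.map_source hx)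
  refine ⟨e.symm '' B, ?_, ?_⟩
  · rw [e.symm_image_eq_source_inter_preimage hBt]
    exact inter_mem (e.open_source.mem_nhds hx)
      ((e.continuousAt hx).preimage_mem_nhds (mem_interior_iff_mem_nhds.1 hxB))
  · rw [h.measure_image_symm hB.measurableSet hBt]
    obtain ⟨C, hC⟩ := hB.exists_bound_of_continuousOn (h.contDiffOn.continuousOn.mono hBt)
    calc ∫⁻ z in B, ENNReal.ofReal (w z) ≤ ∫⁻ _ in B, ENNReal.ofReal C :=
          setLIntegral_mono measurable_const fun z hz =>
            ENNReal.ofReal_le_ofReal ((le_abs_self _).trans (hC z hz))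
      _ < ⊤ := by
          rw [setLIntegral_const]
          exact ENNReal.mul_lt_top ENNReal.ofReal_lt_top hB.measure_lt_top

theorem measure_ne_zero [(volume : Measure F).IsOpenPosMeasure] (h : HasDensityInChart μ e w)
    {x : M} (hx : x ∈ e.source) {U : Set M} (hU : IsOpen U) (hxU : x ∈ U) : μ U ≠ 0 := by
  intro h0
  set S := e.target ∩ e.symm ⁻¹' U
  have hS : IsOpen S := e.isOpen_inter_preimage_symm hU
  have hxS : e x ∈ S := ⟨e.map_source hx, by rwa [mem_preimage, e.left_inv hx]⟩
  have hint : ∫⁻ z in S, ENNReal.ofReal (w z) = 0 := by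
    rw [← h.measure_image_symm hS.measurableSet inter_subset_left]
    exact measure_mono_null (image_subset_iff.2 inter_subset_right) h0
  rw [setLIntegral_eq_zero_iff' hS.measurableSet ((h.contDiffOn.continuousOn.mono
    inter_subset_left).aemeasurable hS.measurableSet).ennreal_ofReal] at hint
  refine (hS.measure_pos volume ⟨_, hxS⟩).ne' (measure_eq_zero_iff_ae_notMem.2 ?_)
  filter_upwards [hint] with z hz hzS
  exact (ENNReal.ofReal_pos.2 (h.pos z hzS.1)).ne' (hz hzS)

end HasDensityInChart

namespace IsSmoothDensity

variable {n : ℕ} {M : Type*} [TopologicalSpace M] [MeasurableSpace M] [BorelSpace M]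
  [ChartedSpace (Euc n) M] {μ : Measure M}

theorem isLocallyFiniteMeasure (hμ : IsSmoothDensity n μ) : IsLocallyFiniteMeasure μ where
  finiteAtNhds x :=
    have ⟨_, hw⟩ := hμ x
    have ⟨s, hs, hs'⟩ := hw.exists_mem_nhds_measure_lt_top (mem_chart_source _ x)
    ⟨s, hs, hs'⟩

theorem isOpenPosMeasure (hμ : IsSmoothDensity n μ) : μ.IsOpenPosMeasure where
  open_pos _ hU := fun ⟨x, hx⟩ =>
    have ⟨_, hw⟩ := hμ x
    hw.measure_ne_zero (mem_chart_source _ x) hU hx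

theorem exists_hasDensityInChart [IsManifold (𝓡 n) ∞ M] {F : Type*} [NormedAddCommGroup F]
    [NormedSpace ℝ F] [MeasureSpace F] [BorelSpace F] [FiniteDimensional ℝ F]
    [(volume : Measure F).IsAddHaarMeasure] {e : OpenPartialHomeomorph M F}
    (hμ : IsSmoothDensity n μ) (he : IsSmoothChart n e) {x : M} (hx : x ∈ e.source)
    (hex : e.source ⊆ (chartAt (Euc n) x).source) : ∃ w, HasDensityInChart μ e w := by
  have : IsManifold (𝓡 n) 1 M := IsManifold.of_le (n := ∞) (by simp)
  obtain ⟨w₀, hw₀⟩ := hμ x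
  let L : F ≃L[ℝ] Euc n := (he.mdifferentiable.mfderiv hx).symm
  have : (Measure.map L (volume : Measure F)).IsAddHaarMeasure := L.isAddHaarMeasure_map volume
  exact ⟨_, (hw₀.transHomeomorph L (Measure.addHaarScalarFactor_pos_of_isAddHaarMeasure _ _)
    (Measure.isAddLeftInvariant_eq_smul _ _)).change_chart
      ((isSmoothChart_chartAt x).transHomeomorph L.symm) he hex⟩

end IsSmoothDensity

/-! ## Charts adapted to a submersion -/

/-- The smooth charts `e` of `M` and `e'` of `M'` exhibit the map `p : M' → M` as the projection of
a product: the normal form of a submersion, the factor `H` being a coordinate along the fibres. -/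
structure IsSubmersionChart (n n' : ℕ) {M M' : Type*} [TopologicalSpace M]
    [ChartedSpace (Euc n) M] [TopologicalSpace M'] [ChartedSpace (Euc n') M']
    {F H : Type*} [NormedAddCommGroup F] [NormedSpace ℝ F] [NormedAddCommGroup H]
    [NormedSpace ℝ H] (p : M' → M) (e : OpenPartialHomeomorph M F)
    (e' : OpenPartialHomeomorph M' (F × H)) : Prop where
  smooth : IsSmoothChart n e
  smooth' : IsSmoothChart n' e'
  mapsTo : MapsTo p e'.source e.source
  fst_eq : ∀ x ∈ e'.source, (e' x).1 = e (p x)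

section Submersion

variable {n n' : ℕ} {M M' : Type*} [TopologicalSpace M] [ChartedSpace (Euc n) M]
  [TopologicalSpace M'] [ChartedSpace (Euc n') M']
  {F H : Type*} [NormedAddCommGroup F] [NormedSpace ℝ F] [NormedAddCommGroup H]
  [NormedSpace ℝ H] {p : M' → M}
  {e : OpenPartialHomeomorph M F} {e' : OpenPartialHomeomorph M' (F × H)}

namespace IsSubmersionChart

theorem symm_fst (h : IsSubmersionChart n n' p e e') {z : F × H} (hz : z ∈ e'.target) :
    e.symm z.1 = p (e'.symm z) := by
  have hx := e'.map_target hz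
  rw [← e.left_inv (h.mapsTo hx), ← h.fst_eq _ hx, e'.right_inv hz]

theorem fst_mem_target (h : IsSubmersionChart n n' p e e') {z : F × H} (hz : z ∈ e'.target) :
    z.1 ∈ e.target := by
  have hx := e'.map_target hz
  rw [← e'.right_inv hz, h.fst_eq _ hx]
  exact e.map_source (h.mapsTo hx)

theorem restrOpen (h : IsSubmersionChart n n' p e e') {O : Set M'} (hO : IsOpen O) :
    IsSubmersionChart n n' p e (e'.restrOpen O hO) where
  smooth := h.smooth
  smooth' := h.smooth'.restrOpen hO
  mapsTo := h.mapsTo.mono_left inter_subset_left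
  fst_eq x hx := h.fst_eq x hx.1

theorem change_base {F₁ : Type*} [NormedAddCommGroup F₁] [NormedSpace ℝ F₁]
    (h : IsSubmersionChart n n' p e e') {e₁ : OpenPartialHomeomorph M F₁}
    (h₁ : IsSmoothChart n e₁) :
    IsSubmersionChart n n' p e₁
      (e'.trans ((e.symm.trans e₁).prod (OpenPartialHomeomorph.refl H))) where
  smooth := h₁
  smooth' := h.smooth'.trans ((h.smooth.contDiffOn_comp_symm h₁).prodMap contDiffOn_id)
    ((h₁.contDiffOn_comp_symm h.smooth).prodMap contDiffOn_id)
  mapsTo x hx := by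
    have hx₁ : e.symm (e' x).1 ∈ e₁.source := hx.2.1.2
    rwa [h.fst_eq x hx.1, e.left_inv (h.mapsTo hx.1)] at hx₁
  fst_eq x hx := by
    change e₁ (e.symm (e' x).1) = e₁ (p x)
    rw [h.fst_eq x hx.1, e.left_inv (h.mapsTo hx.1)]

theorem mem_source_change_base {F₁ : Type*} [TopologicalSpace F₁]
    (h : IsSubmersionChart n n' p e e') {e₁ : OpenPartialHomeomorph M F₁} {x : M'}
    (hx : x ∈ e'.source) (hx₁ : p x ∈ e₁.source) :
    x ∈ (e'.trans ((e.symm.trans e₁).prod (OpenPartialHomeomorph.refl H))).source := by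
  have hpx : e.symm (e' x).1 = p x := by rw [h.fst_eq x hx, e.left_inv (h.mapsTo hx)]
  refine ⟨hx, ⟨?_, ?_⟩, trivial⟩
  · exact h.fst_eq x hx ▸ e.map_source (h.mapsTo hx)
  · exact mem_preimage.2 (hpx.symm ▸ hx₁)

end IsSubmersionChart

theorem exists_chart_isSubmersionChart (hp : Manifold.IsSubmersion (𝓡 n') (𝓡 n) ∞ p)
    (x : M') : ∃ (r : ℕ) (e : OpenPartialHomeomorph M (Euc n))
      (e' : OpenPartialHomeomorph M' (Euc n × Euc r)),
      IsSubmersionChart n n' p e e' ∧ x ∈ e'.source := by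
  obtain ⟨C, _, _, hC⟩ := hp
  have h := hC x
  have : FiniteDimensional ℝ (Euc n × C) := h.equiv.toLinearEquiv.finiteDimensional
  have : FiniteDimensional ℝ C :=
    FiniteDimensional.of_injective (LinearMap.inr ℝ (Euc n) C) LinearMap.inr_injective
  let Q : Euc n' ≃L[ℝ] (Euc n × Euc (Module.finrank ℝ C)) := h.equiv.trans
    ((ContinuousLinearEquiv.refl ℝ (Euc n)).prodCongr
      (ContinuousLinearEquiv.ofFinrankEq finrank_euclideanSpace_fin.symm))
  refine ⟨_, h.codChart, h.domChart.transHomeomorph Q.toHomeomorph, ⟨?_, ?_, ?_, fun y hy => ?_⟩,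
    h.mem_domChart_source⟩
  · exact isSmoothChart_of_mem_maximalAtlas h.codChart_mem_maximalAtlas
  · exact (isSmoothChart_of_mem_maximalAtlas h.domChart_mem_maximalAtlas).transHomeomorph Q
  · exact h.source_subset_preimage_source
  · have hy' : h.domChart y ∈ (h.domChart.extend (𝓡 n')).target := by
      rw [OpenPartialHomeomorph.extend_target]
      exact ⟨h.domChart.map_source hy, by simp⟩
    have hwritten := h.writtenInCharts hy'
    simp only [Function.comp_apply, OpenPartialHomeomorph.extend_coe,
      OpenPartialHomeomorph.extend_coe_symm, modelWithCornersSelf_coe,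
      modelWithCornersSelf_coe_symm, id, h.domChart.left_inv hy] at hwritten
    exact hwritten.symm

theorem exists_isSubmersionChart (hp : Manifold.IsSubmersion (𝓡 n') (𝓡 n) ∞ p)
    (he : IsSmoothChart n e) {x : M'} (hx : p x ∈ e.source) {O : Set M'} (hO : O ∈ 𝓝 x) :
    ∃ (r : ℕ) (e' : OpenPartialHomeomorph M' (F × Euc r)),
      IsSubmersionChart n n' p e e' ∧ x ∈ e'.source ∧ e'.source ⊆ O := by
  obtain ⟨r, e₀, e₀', h₀, hx₀⟩ := exists_chart_isSubmersionChart hp x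
  obtain ⟨O', hO'O, hO', hxO'⟩ := mem_nhds_iff.1 hO
  exact ⟨r, _, (h₀.change_base he).restrOpen hO', ⟨h₀.mem_source_change_base hx₀ hx, hxO'⟩,
    inter_subset_right.trans hO'O⟩

end Submersion

/-! ## Integration along the fibres in charts -/

section ChartDensity

/-- The coefficient of the density `f μ` in the chart `e`, where `μ = w(z) dz`, extended by zero. -/
def chartDensity {M F : Type*} [TopologicalSpace M] [TopologicalSpace F]
    (e : OpenPartialHomeomorph M F) (w : F → ℝ) (f : M → ℂ) : F → ℂ :=
  e.target.indicator fun z => f (e.symm z) * (w z : ℂ)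

section Support

variable {n : ℕ} {M F : Type*} [TopologicalSpace M] [TopologicalSpace F]
  {e : OpenPartialHomeomorph M F} {w : F → ℝ}

theorem chartDensity_eq_zero {f : M → ℂ} {z : F} (hz : z ∉ e '' tsupport f) :
    chartDensity e w f z = 0 := by
  by_contra h
  obtain ⟨hze, hne⟩ := indicator_apply_ne_zero.1 h
  exact hz ⟨e.symm z, subset_tsupport _ (left_ne_zero_of_mul hne), e.right_inv hze⟩

variable [ChartedSpace (Euc n) M] [T2Space F] {f : testFunctions n M}

theorem tsupport_chartDensity_subset (hf : tsupport (f : M → ℂ) ⊆ e.source) :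
    tsupport (chartDensity e w f) ⊆ e '' tsupport (f : M → ℂ) :=
  closure_minimal (fun _ hz => by_contra fun h => hz (chartDensity_eq_zero h))
    (f.2.2.isCompact.image_of_continuousOn (e.continuousOn.mono hf)).isClosed

theorem tsupport_chartDensity_subset_target (hf : tsupport (f : M → ℂ) ⊆ e.source) :
    tsupport (chartDensity e w f) ⊆ e.target :=
  (tsupport_chartDensity_subset hf).trans (image_subset_iff.2 fun _ hy => e.map_source (hf hy))

theorem hasCompactSupport_chartDensity (hf : tsupport (f : M → ℂ) ⊆ e.source) :
    HasCompactSupport (chartDensity e w f) :=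
  (f.2.2.isCompact.image_of_continuousOn (e.continuousOn.mono hf)).of_isClosed_subset
    (isClosed_tsupport _) (tsupport_chartDensity_subset hf)

end Support

variable {n : ℕ} {M : Type*} [TopologicalSpace M] [ChartedSpace (Euc n) M] [MeasurableSpace M]
  {F : Type*} [NormedAddCommGroup F] [NormedSpace ℝ F] [MeasureSpace F]
  {μ : Measure M} {e : OpenPartialHomeomorph M F} {w : F → ℝ} {f : testFunctions n M}

theorem contDiff_chartDensity (he : IsSmoothChart n e) (hw : HasDensityInChart μ e w)
    (hf : tsupport (f : M → ℂ) ⊆ e.source) :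
    ContDiff ℝ ∞ (chartDensity e w f) :=
  contDiff_indicator e.open_target (isClosed_tsupport _) (tsupport_chartDensity_subset_target hf)
    (((he.comp_contDiffOn (contMDiffOn_univ.2 f.2.1)).mono fun _ hz => ⟨hz, mem_univ _⟩).mul
      (Complex.ofRealCLM.contDiff.comp_contDiffOn hw.contDiffOn))
    fun _ hz hzK => (indicator_of_mem hz _).symm.trans (image_eq_zero_of_notMem_tsupport hzK)

theorem integral_mul_eq_integral_chartDensity [BorelSpace M] [BorelSpace F]
    (hw : HasDensityInChart μ e w) {u : M → ℂ}
    (hu : ContinuousOn u e.source) (hf : tsupport (f : M → ℂ) ⊆ e.source) :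
    ∫ y, u y * (f : M → ℂ) y ∂μ = ∫ z, u (e.symm z) * chartDensity e w f z := by
  have h0 (y) (hy : y ∉ e.source) : u y * (f : M → ℂ) y = 0 := by
    rw [image_eq_zero_of_notMem_tsupport fun hy' => hy (hf hy'), mul_zero]
  rw [hw.integral_eq (φ := fun y => u y * (f : M → ℂ) y)
      (hu.mul f.2.1.continuous.continuousOn) h0,
    ← integral_indicator e.open_target.measurableSet]
  congr with z
  by_cases hz : z ∈ e.target
  · simp only [chartDensity, indicator_of_mem hz]
    ring
  · simp only [chartDensity, indicator_of_notMem hz, mul_zero]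

end ChartDensity

namespace IsSubmersionChart

variable {n n' : ℕ} {M M' : Type*} [TopologicalSpace M] [ChartedSpace (Euc n) M]
  [TopologicalSpace M'] [ChartedSpace (Euc n') M']
  {F H : Type*} [NormedAddCommGroup F] [NormedSpace ℝ F]
  [NormedAddCommGroup H] [NormedSpace ℝ H] [MeasureSpace H]
  {p : M' → M} {e : OpenPartialHomeomorph M F} {e' : OpenPartialHomeomorph M' (F × H)}
  {w : F → ℝ} {w' : F × H → ℝ} {f : testFunctions n' M'}

theorem partialIntegral_eq_zero (h : IsSubmersionChart n n' p e e')
    (hf : tsupport (f : M' → ℂ) ⊆ e'.source) {y : F} (hy : y ∉ e '' (p '' tsupport (f : M' → ℂ))) :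
    ∫ z, chartDensity e' w' f (y, z) = 0 := by
  refine integral_eq_zero_of_ae (Eventually.of_forall fun z => chartDensity_eq_zero ?_)
  rintro ⟨x, hx, hxz⟩
  exact hy ⟨p x, ⟨x, hx, rfl⟩, by rw [← h.fst_eq x (hf hx), hxz]⟩

variable [MeasurableSpace M] [MeasurableSpace M'] [MeasureSpace F] [BorelSpace H]
  [IsFiniteMeasureOnCompacts (volume : Measure H)] {μ : Measure M} {μ' : Measure M'}

theorem exists_chartDensity_eq_partialIntegral [T2Space M]
    (h : IsSubmersionChart n n' p e e') (hp : Continuous p)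
    (hw : HasDensityInChart μ e w) (hw' : HasDensityInChart μ' e' w')
    (hf : tsupport (f : M' → ℂ) ⊆ e'.source) :
    ∃ g : testFunctions n M, tsupport (g : M → ℂ) ⊆ p '' tsupport (f : M' → ℂ) ∧
      chartDensity e w g = fun y => ∫ z, chartDensity e' w' f (y, z) := by
  have hI : ContDiff ℝ ∞ fun y => ∫ z, chartDensity e' w' f (y, z) := contDiff_partialIntegral
    volume (contDiff_chartDensity h.smooth' hw' hf) (hasCompactSupport_chartDensity hf)
  have hpf : p '' tsupport (f : M' → ℂ) ⊆ e.source := (image_mono hf).trans h.mapsTo.image_subset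
  have hw0 : ∀ z ∈ e.target, (w z : ℂ) ≠ 0 := fun z hz =>
    Complex.ofReal_ne_zero.2 (hw.pos z hz).ne'
  obtain ⟨g, hgs, hg⟩ := h.smooth.exists_testFunction
    (φ := fun y => (w y : ℂ)⁻¹ * ∫ z, chartDensity e' w' f (y, z))
    (((Complex.ofRealCLM.contDiff.comp_contDiffOn hw.contDiffOn).inv hw0).mul hI.contDiffOn)
    ((f.2.2.isCompact.image hp).image_of_continuousOn (e.continuousOn.mono hpf))
    (image_subset_iff.2 fun y hy => e.map_source (hpf hy))
    fun z _ hz => mul_eq_zero_of_right _ (h.partialIntegral_eq_zero hf hz)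
  refine ⟨g, hgs.trans (e.toPartialEquiv.symm_image_image_of_subset_source hpf).subset,
    funext fun z => ?_⟩
  by_cases hz : z ∈ e.target
  · rw [chartDensity, indicator_of_mem hz, hg, indicator_of_mem (e.map_target hz),
      Function.comp_apply, e.right_inv hz, mul_right_comm, inv_mul_cancel₀ (hw0 z hz), one_mul]
  · rw [chartDensity, indicator_of_notMem hz, eq_comm]
    exact h.partialIntegral_eq_zero hf fun ⟨y, hy, hyz⟩ => hz (hyz ▸ e.map_source (hpf hy))

theorem integral_comp_mul_eq [BorelSpace M] [BorelSpace M'] [BorelSpace F]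
    [FiniteDimensional ℝ H] [SFinite (volume : Measure F)]
    [IsFiniteMeasureOnCompacts (volume : Measure F)]
    (h : IsSubmersionChart n n' p e e') (hp : Continuous p)
    (hw : HasDensityInChart μ e w) (hw' : HasDensityInChart μ' e' w')
    (hf : tsupport (f : M' → ℂ) ⊆ e'.source)
    {g : testFunctions n M} (hg : tsupport (g : M → ℂ) ⊆ e.source)
    (hfg : chartDensity e w g = fun y => ∫ z, chartDensity e' w' f (y, z))
    {u : M → ℂ} (hu : ContinuousOn u e.source) :
    ∫ x, u (p x) * (f : M' → ℂ) x ∂μ' = ∫ y, u y * (g : M → ℂ) y ∂μ := by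
  set Φ := chartDensity e' w' f
  have hΦ : tsupport Φ ⊆ e'.target := tsupport_chartDensity_subset_target hf
  have hint : Integrable fun z : F × H => u (e.symm z.1) * Φ z := by
    rw [← integrableOn_iff_integrable_of_support_subset (s := tsupport Φ)
      ((Function.support_mul_subset_right _ _).trans (subset_tsupport Φ))]
    refine ContinuousOn.integrableOn_compact (hasCompactSupport_chartDensity hf) ?_
    exact (hu.comp e.continuousOn_symm e.mapsTo_symm |>.comp continuousOn_fst
      fun z hz => h.fst_mem_target (hΦ hz)).mul
        (contDiff_chartDensity h.smooth' hw' hf).continuous.continuousOn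
  calc ∫ x, u (p x) * (f : M' → ℂ) x ∂μ' = ∫ z, u (p (e'.symm z)) * Φ z :=
        integral_mul_eq_integral_chartDensity hw' (hu.comp hp.continuousOn h.mapsTo) hf
    _ = ∫ z : F × H, u (e.symm z.1) * Φ z := by
        congr with z
        by_cases hz : z ∈ e'.target
        · rw [h.symm_fst hz]
        · rw [image_eq_zero_of_notMem_tsupport fun hz' => hz (hΦ hz'), mul_zero, mul_zero]
    _ = ∫ y, u (e.symm y) * ∫ z, Φ (y, z) := by
        rw [Measure.volume_eq_prod, integral_prod _ hint]
        simp only [integral_const_mul]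
    _ = ∫ y, u y * (g : M → ℂ) y ∂μ := by
        rw [integral_mul_eq_integral_chartDensity hw hu hg, hfg]

end IsSubmersionChart

/-! ## Continuity of the integration along the fibres -/

section TestMul

variable {n : ℕ} {M : Type*} [TopologicalSpace M] [ChartedSpace (Euc n) M]
  {χ : M → ℂ} (hχ : ContMDiff (𝓡 n) 𝓘(ℝ, ℂ) ∞ χ)

/-- The product of a test function with the smooth function `χ`. -/
def testMul (f : testFunctions n M) : testFunctions n M :=
  ⟨fun y => χ y * (f : M → ℂ) y, contDiff_mul.comp_contMDiff (hχ.prodMk_space f.2.1),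
    f.2.2.mul_left⟩

theorem tsupport_testMul_subset_left (f : testFunctions n M) :
    tsupport (testMul hχ f : M → ℂ) ⊆ tsupport χ :=
  closure_mono fun _ hy => left_ne_zero_of_mul hy

theorem tsupport_testMul_subset_right (f : testFunctions n M) :
    tsupport (testMul hχ f : M → ℂ) ⊆ tsupport (f : M → ℂ) :=
  closure_mono fun _ hy => right_ne_zero_of_mul hy

end TestMul

namespace TendstoZero

variable {n : ℕ} {M : Type*} [TopologicalSpace M] [ChartedSpace (Euc n) M]
  {f g : ℕ → testFunctions n M}

theorem zero : TendstoZero fun _ => (0 : testFunctions n M) :=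
  ⟨⟨∅, isCompact_empty, fun _ => (tsupport_eq_empty_iff.2 rfl).subset⟩,
    fun _ => SmoothCvgZero.zero.tendstoUniformlyOn⟩

variable [IsManifold (𝓡 n) ∞ M]

theorem smoothCvgZero_chartAt (hf : TendstoZero f) (x : M) :
    SmoothCvgZero (chartAt (Euc n) x).target
      fun i => (f i : M → ℂ) ∘ (chartAt (Euc n) x).symm where
  contDiffOn i := ((isSmoothChart_chartAt x).comp_contDiffOn
    (contMDiffOn_univ.2 (f i).2.1)).mono fun _ hz => ⟨hz, mem_univ _⟩
  tendstoUniformlyOn := hf.2 x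

theorem testMul (hf : TendstoZero f) {χ : M → ℂ} (hχ : ContMDiff (𝓡 n) 𝓘(ℝ, ℂ) ∞ χ) :
    TendstoZero fun i => testMul hχ (f i) := by
  obtain ⟨K, hK, hfK⟩ := hf.1
  refine ⟨⟨K, hK, fun i => (tsupport_testMul_subset_right hχ (f i)).trans (hfK i)⟩, fun x => ?_⟩
  have hχx : ContDiffOn ℝ ∞ (χ ∘ (chartAt (Euc n) x).symm) (chartAt (Euc n) x).target :=
    ((isSmoothChart_chartAt x).comp_contDiffOn (contMDiffOn_univ.2 hχ)).mono
      fun _ hz => ⟨hz, mem_univ _⟩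
  exact ((hf.smoothCvgZero_chartAt x).mul (chartAt (Euc n) x).open_target hχx).tendstoUniformlyOn

theorem add (hf : TendstoZero f) (hg : TendstoZero g) : TendstoZero fun i => f i + g i := by
  obtain ⟨K, hK, hfK⟩ := hf.1
  obtain ⟨L, hL, hgL⟩ := hg.1
  refine ⟨⟨K ∪ L, hK.union hL, fun i => (tsupport_add _ _).trans
    (union_subset_union (hfK i) (hgL i))⟩, fun x => ?_⟩
  exact ((hf.smoothCvgZero_chartAt x).add (chartAt (Euc n) x).open_target
    (hg.smoothCvgZero_chartAt x)).tendstoUniformlyOn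

theorem sum {ι : Type*} (t : Finset ι) {f : ι → ℕ → testFunctions n M}
    (hf : ∀ a ∈ t, TendstoZero (f a)) : TendstoZero fun i => ∑ a ∈ t, f a i := by
  classical
  induction t using Finset.induction_on with
  | empty => simpa only [Finset.sum_empty] using zero
  | insert a t ha ih =>
    simp only [Finset.sum_insert ha]
    exact (hf a (Finset.mem_insert_self a t)).add
      (ih fun b hb => hf b (Finset.mem_insert_of_mem hb))

variable {F : Type*} [NormedAddCommGroup F] [NormedSpace ℝ F]
  {e : OpenPartialHomeomorph M F} {K : Set M}

theorem smoothCvgZero_chart [FiniteDimensional ℝ F] (hf : TendstoZero f)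
    (he : IsSmoothChart n e) :
    SmoothCvgZero e.target fun i z => (f i : M → ℂ) (e.symm z) := by
  refine SmoothCvgZero.of_locally fun z hz => ?_
  set c := chartAt (Euc n) (e.symm z)
  have hO : IsOpen (e.target ∩ e.symm ⁻¹' c.source) := e.isOpen_inter_preimage_symm c.open_source
  refine ⟨_, hO, ⟨hz, mem_chart_source _ _⟩, ?_⟩
  refine ((hf.smoothCvgZero_chartAt (e.symm z)).comp c.open_target hO
    (he.contDiffOn_comp_symm (isSmoothChart_chartAt (e.symm z)))
    fun y hy => c.map_source hy.2).congr hO fun i y hy => ?_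
  exact congrArg (f i : M → ℂ) (c.left_inv hy.2).symm

theorem of_chart [T2Space M] (he : IsSmoothChart n e) (hK : IsCompact K) (hKe : K ⊆ e.source)
    (hfK : ∀ i, tsupport (f i : M → ℂ) ⊆ K)
    (h : SmoothCvgZero e.target fun i z => (f i : M → ℂ) (e.symm z)) : TendstoZero f := by
  refine ⟨⟨K, hK, hfK⟩, fun x => SmoothCvgZero.tendstoUniformlyOn (Ω := (chartAt _ x).target) ?_⟩
  set c := chartAt (Euc n) x
  refine SmoothCvgZero.of_locally fun z hz => ?_
  by_cases hze : c.symm z ∈ e.source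
  · have hO := c.isOpen_inter_preimage_symm e.open_source
    refine ⟨_, hO, ⟨hz, hze⟩, ?_⟩
    refine (h.comp e.open_target hO ((isSmoothChart_chartAt x).contDiffOn_comp_symm he)
      fun y hy => e.map_source hy.2).congr hO fun i y hy => ?_
    exact congrArg (f i : M → ℂ) (e.left_inv hy.2).symm
  · have hO := c.isOpen_inter_preimage_symm hK.isClosed.isOpen_compl
    refine ⟨_, hO, ⟨hz, fun hzK => hze (hKe hzK)⟩, ?_⟩
    exact SmoothCvgZero.zero.congr hO fun i y hy =>
      image_eq_zero_of_notMem_tsupport (f := (f i : M → ℂ)) fun hy' => hy.2 (hfK i hy')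

variable [MeasurableSpace M] [MeasureSpace F] {μ : Measure M} {w : F → ℝ}

theorem smoothCvgZero_chartDensity [FiniteDimensional ℝ F] (hf : TendstoZero f)
    (he : IsSmoothChart n e) (hw : HasDensityInChart μ e w) (hK : IsCompact K) (hKe : K ⊆ e.source)
    (hfK : ∀ i, tsupport (f i : M → ℂ) ⊆ K) :
    SmoothCvgZero univ fun i => chartDensity e w (f i) := by
  refine SmoothCvgZero.of_locally fun z _ => ?_
  by_cases hz : z ∈ e.target
  · refine ⟨_, e.open_target, hz, ((hf.smoothCvgZero_chart he).mul e.open_target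
      (Complex.ofRealCLM.contDiff.comp_contDiffOn hw.contDiffOn)).congr e.open_target
      fun i y hy => ?_⟩
    rw [chartDensity, indicator_of_mem hy, mul_comm]
    rfl
  · have hO : IsOpen (e '' K)ᶜ :=
      (hK.image_of_continuousOn (e.continuousOn.mono hKe)).isClosed.isOpen_compl
    refine ⟨_, hO, fun ⟨x, hx, hxz⟩ => hz (hxz ▸ e.map_source (hKe hx)), ?_⟩
    exact SmoothCvgZero.zero.congr hO fun i y hy =>
      chartDensity_eq_zero fun hy' => hy (image_mono (hfK i) hy')

theorem of_chartDensity [T2Space M] (he : IsSmoothChart n e)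
    (hw : HasDensityInChart μ e w) (hK : IsCompact K) (hKe : K ⊆ e.source)
    (hfK : ∀ i, tsupport (f i : M → ℂ) ⊆ K)
    (h : SmoothCvgZero univ fun i => chartDensity e w (f i)) : TendstoZero f := by
  have hw0 : ∀ z ∈ e.target, (w z : ℂ) ≠ 0 := fun z hz =>
    Complex.ofReal_ne_zero.2 (hw.pos z hz).ne'
  refine of_chart he hK hKe hfK (((h.comp isOpen_univ e.open_target contDiffOn_id
    (mapsTo_univ _ _)).mul e.open_target
    ((Complex.ofRealCLM.contDiff.comp_contDiffOn hw.contDiffOn).inv hw0)).congr e.open_target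
    fun i z hz => ?_)
  change _ = (w z : ℂ)⁻¹ * chartDensity e w (f i) z
  rw [chartDensity, indicator_of_mem hz, mul_left_comm, inv_mul_cancel₀ (hw0 z hz), mul_one]

end TendstoZero

theorem IsSubmersionChart.tendstoZero_of_chartDensity_eq {n n' : ℕ} {M M' : Type*}
    [TopologicalSpace M] [ChartedSpace (Euc n) M] [IsManifold (𝓡 n) ∞ M] [T2Space M]
    [TopologicalSpace M'] [ChartedSpace (Euc n') M'] [IsManifold (𝓡 n') ∞ M']
    [MeasurableSpace M] [MeasurableSpace M']
    {F H : Type*} [NormedAddCommGroup F] [NormedSpace ℝ F] [FiniteDimensional ℝ F] [MeasureSpace F]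
    [NormedAddCommGroup H] [NormedSpace ℝ H] [FiniteDimensional ℝ H] [MeasureSpace H]
    [BorelSpace H] [IsFiniteMeasureOnCompacts (volume : Measure H)]
    {p : M' → M} {e : OpenPartialHomeomorph M F} {e' : OpenPartialHomeomorph M' (F × H)}
    {μ : Measure M} {μ' : Measure M'} {w : F → ℝ} {w' : F × H → ℝ}
    (h : IsSubmersionChart n n' p e e') (hp : Continuous p)
    (hw : HasDensityInChart μ e w) (hw' : HasDensityInChart μ' e' w')
    {K : Set M'} (hK : IsCompact K) (hKe : K ⊆ e'.source)
    {f : ℕ → testFunctions n' M'} (hf : TendstoZero f) (hfK : ∀ i, tsupport (f i : M' → ℂ) ⊆ K)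
    {g : ℕ → testFunctions n M} (hgK : ∀ i, tsupport (g i : M → ℂ) ⊆ p '' K)
    (hfg : ∀ i, chartDensity e w (g i) = fun y => ∫ z, chartDensity e' w' (f i) (y, z)) :
    TendstoZero g := by
  refine TendstoZero.of_chartDensity h.smooth hw (hK.image hp)
    ((image_mono hKe).trans h.mapsTo.image_subset) hgK ?_
  simp only [hfg]
  exact (hf.smoothCvgZero_chartDensity h.smooth' hw' hK hKe hfK).partialIntegral volume
    (hK.image_of_continuousOn (e'.continuousOn.mono hKe))
    fun i => (tsupport_chartDensity_subset ((hfK i).trans hKe)).trans (image_mono (hfK i))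

/-! ## Integration along the fibres and pull-back of distributions -/

section TestFunctions

variable {n : ℕ} {M : Type*} [TopologicalSpace M] [ChartedSpace (Euc n) M]

/-- The complex conjugate of a test function. -/
def testConj (f : testFunctions n M) : testFunctions n M :=
  ⟨fun y => star ((f : M → ℂ) y), Complex.conjCLE.contDiff.comp_contMDiff f.2.1,
    f.2.2.comp_left (g := star) (star_zero ℂ)⟩

theorem isClosed_support (P : Distr n M) : IsClosed P.support := by
  refine isClosed_of_closure_subset fun x hx U hU => ?_
  obtain ⟨y, hyU, hy⟩ := mem_closure_iff_nhds.1 hx _ (eventually_mem_nhds_iff.2 hU)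
  exact hy U hyU

theorem exists_finset_contMDiff_sum_eq_one [IsManifold (𝓡 n) ∞ M] [T2Space M]
    [SecondCountableTopology M] {K : Set M} (hK : IsCompact K) (W : M → Set M)
    (hW : ∀ x, IsOpen (W x)) (hxW : ∀ x, x ∈ W x) :
    ∃ (t : Finset M) (χ : M → M → ℂ), (∀ x, ContMDiff (𝓡 n) 𝓘(ℝ, ℂ) ∞ (χ x)) ∧
      (∀ x, tsupport (χ x) ⊆ W x) ∧ ∀ y ∈ K, ∑ x ∈ t, χ x y = 1 := by
  have : LocallyCompactSpace M := ChartedSpace.locallyCompactSpace (Euc n) M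
  obtain ⟨ρ, hρ⟩ := SmoothPartitionOfUnity.exists_isSubordinate (𝓡 n) hK.isClosed W hW
    fun x _ => mem_iUnion.2 ⟨x, hxW x⟩
  have hfin := ρ.locallyFinite.finite_nonempty_inter_compact hK
  refine ⟨hfin.toFinset, fun x y => (ρ x y : ℂ), fun x =>
    Complex.ofRealCLM.contDiff.comp_contMDiff (ρ x).contMDiff, fun x => ?_, fun y hy => ?_⟩
  · refine (closure_mono fun y hy => ?_).trans (hρ x)
    exact Complex.ofReal_ne_zero.1 hy
  · have hsum := ρ.sum_eq_one hy
    rw [finsum_eq_sum_of_support_subset (s := hfin.toFinset) _ fun x hx =>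
      Finset.mem_coe.2 (hfin.mem_toFinset.2 ⟨y, hx, hy⟩)] at hsum
    simpa using congrArg Complex.ofReal hsum

theorem sum_testMul_eq_self {ι : Type*} {t : Finset ι} {χ : ι → M → ℂ}
    (hχ : ∀ x, ContMDiff (𝓡 n) 𝓘(ℝ, ℂ) ∞ (χ x)) {f : testFunctions n M}
    (hχf : ∀ y ∈ tsupport (f : M → ℂ), ∑ x ∈ t, χ x y = 1) : ∑ x ∈ t, testMul (hχ x) f = f := by
  refine Subtype.ext (funext fun y => ?_)
  rw [Submodule.coe_sum, Finset.sum_apply]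
  change ∑ x ∈ t, χ x y * (f : M → ℂ) y = _
  rw [← Finset.sum_mul]
  by_cases hy : y ∈ tsupport (f : M → ℂ)
  · rw [hχf y hy, one_mul]
  · rw [image_eq_zero_of_notMem_tsupport hy, mul_zero]

variable [MeasurableSpace M] [BorelSpace M] {μ : Measure M} [IsFiniteMeasureOnCompacts μ]

theorem integrable_mul_testFunction {h : M → ℂ} (hh : Continuous h) (f : testFunctions n M) :
    Integrable (fun y => h y * (f : M → ℂ) y) μ :=
  (hh.mul f.2.1.continuous).integrable_of_hasCompactSupport f.2.2.mul_left

theorem testFunction_eq_zero_of_integral_eq_zero [μ.IsOpenPosMeasure] {g : testFunctions n M}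
    (h : ∀ u : testFunctions n M, ∫ y, (u : M → ℂ) y * (g : M → ℂ) y ∂μ = 0) : g = 0 := by
  have hsq : ∫ y, Complex.normSq ((g : M → ℂ) y) ∂μ = 0 := by
    rw [← Complex.ofReal_eq_zero, ← integral_complex_ofReal, ← h (testConj g)]
    exact integral_congr_ae (Eventually.of_forall fun y => Complex.normSq_eq_conj_mul_self)
  refine Subtype.ext (funext fun x => by_contra fun hx => ?_)
  refine (Continuous.integral_pos_of_hasCompactSupport_nonneg_nonzero (x := x)
    (Complex.continuous_normSq.comp g.2.1.continuous)
    (g.2.2.comp_left (g := Complex.normSq) (map_zero _))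
    (fun y => Complex.normSq_nonneg _) ?_).ne' hsq
  exact Complex.normSq_eq_zero.not.2 hx

theorem testFunction_eq_of_integral_eq [μ.IsOpenPosMeasure] {g₁ g₂ : testFunctions n M}
    (h : ∀ u : testFunctions n M, ∫ y, (u : M → ℂ) y * (g₁ : M → ℂ) y ∂μ =
      ∫ y, (u : M → ℂ) y * (g₂ : M → ℂ) y ∂μ) : g₁ = g₂ := by
  refine sub_eq_zero.1 (testFunction_eq_zero_of_integral_eq_zero (μ := μ) fun u => ?_)
  have hu : Continuous (u : M → ℂ) := u.2.1.continuous
  simp only [Submodule.coe_sub, Pi.sub_apply, mul_sub]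
  rw [integral_sub (integrable_mul_testFunction hu g₁) (integrable_mul_testFunction hu g₂), h,
    sub_self]

end TestFunctions

section FiberIntegral

variable {n n' : ℕ} {M M' : Type*}
  [TopologicalSpace M] [ChartedSpace (Euc n) M] [MeasurableSpace M]
  [TopologicalSpace M'] [ChartedSpace (Euc n') M'] [MeasurableSpace M']
  {μ : Measure M} {μ' : Measure M'} {p : M' → M}

namespace IsFiberIntegral

theorem smul {f : testFunctions n' M'} {g : testFunctions n M}
    (h : IsFiberIntegral μ μ' p f g) (c : ℂ) : IsFiberIntegral μ μ' p (c • f) (c • g) := fun u => by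
  simp only [Submodule.coe_smul, Pi.smul_apply, smul_eq_mul, mul_left_comm _ c, integral_const_mul,
    h u]

variable [BorelSpace M] [IsFiniteMeasureOnCompacts μ]

theorem unique [μ.IsOpenPosMeasure] {f : testFunctions n' M'} {g₁ g₂ : testFunctions n M}
    (h₁ : IsFiberIntegral μ μ' p f g₁) (h₂ : IsFiberIntegral μ μ' p f g₂) : g₁ = g₂ :=
  testFunction_eq_of_integral_eq fun u => (h₁ u).symm.trans (h₂ u)

variable [BorelSpace M'] [IsFiniteMeasureOnCompacts μ']

theorem add (hp : Continuous p) {f₁ f₂ : testFunctions n' M'} {g₁ g₂ : testFunctions n M}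
    (h₁ : IsFiberIntegral μ μ' p f₁ g₁) (h₂ : IsFiberIntegral μ μ' p f₂ g₂) :
    IsFiberIntegral μ μ' p (f₁ + f₂) (g₁ + g₂) := fun u => by
  have hu : Continuous (u : M → ℂ) := u.2.1.continuous
  have hup : Continuous fun x => (u : M → ℂ) (p x) := hu.comp hp
  simp only [Submodule.coe_add, Pi.add_apply, mul_add]
  rw [integral_add (integrable_mul_testFunction hup f₁) (integrable_mul_testFunction hup f₂),
    integral_add (integrable_mul_testFunction hu g₁) (integrable_mul_testFunction hu g₂), h₁, h₂]

theorem sum (hp : Continuous p) {ι : Type*} (t : Finset ι) {f : ι → testFunctions n' M'}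
    {g : ι → testFunctions n M} (h : ∀ i, IsFiberIntegral μ μ' p (f i) (g i)) :
    IsFiberIntegral μ μ' p (∑ i ∈ t, f i) (∑ i ∈ t, g i) := by
  classical
  induction t using Finset.induction_on with
  | empty => intro u; simp
  | insert i t hi ih =>
    rw [Finset.sum_insert hi, Finset.sum_insert hi]
    exact (h i).add hp ih

end IsFiberIntegral

theorem IsPullback.apply_eq [BorelSpace M] (hμ : IsSmoothDensity n μ) {P : Distr n M}
    {P' : Distr n' M'} (h : IsPullback μ μ' p P P') {f : testFunctions n' M'}
    {g : testFunctions n M} (hg : IsFiberIntegral μ μ' p f g) : P'.toLin f = P.toLin g := by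
  have := hμ.isLocallyFiniteMeasure
  have := hμ.isOpenPosMeasure
  obtain ⟨g', hg', hP⟩ := h f
  rw [hP, hg'.unique hg]

end FiberIntegral

section Submersion

variable {n n' : ℕ} {M M' : Type*} [TopologicalSpace M] [ChartedSpace (Euc n) M]
  [TopologicalSpace M'] [ChartedSpace (Euc n') M'] [IsManifold (𝓡 n') ∞ M']
  [MeasurableSpace M'] [BorelSpace M'] {μ' : Measure M'} {p : M' → M}

theorem exists_isSubmersionChart_hasDensityInChart (hμ' : IsSmoothDensity n' μ')
    (hp : Manifold.IsSubmersion (𝓡 n') (𝓡 n) ∞ p) {F : Type*} [NormedAddCommGroup F]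
    [NormedSpace ℝ F] [MeasureSpace F] [BorelSpace F] [FiniteDimensional ℝ F]
    [(volume : Measure F).IsAddHaarMeasure] {e : OpenPartialHomeomorph M F}
    (he : IsSmoothChart n e) {x : M'} (hx : p x ∈ e.source) :
    ∃ (r : ℕ) (e' : OpenPartialHomeomorph M' (F × Euc r)) (w' : F × Euc r → ℝ),
      IsSubmersionChart n n' p e e' ∧ HasDensityInChart μ' e' w' ∧ x ∈ e'.source := by
  obtain ⟨r, e', h, hx', hsub⟩ := exists_isSubmersionChart hp he hx
    ((chartAt (Euc n') x).open_source.mem_nhds (mem_chart_source _ x))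
  obtain ⟨w', hw'⟩ := hμ'.exists_hasDensityInChart h.smooth' hx' hsub
  exact ⟨r, e', w', h, hw', hx'⟩

variable [IsManifold (𝓡 n) ∞ M] [T2Space M] [MeasurableSpace M] [BorelSpace M] {μ : Measure M}

theorem IsPullback.exists_isSmoothOn (hμ : IsSmoothDensity n μ) (hμ' : IsSmoothDensity n' μ')
    (hp : Manifold.IsSubmersion (𝓡 n') (𝓡 n) ∞ p) {P : Distr n M} {P' : Distr n' M'}
    (h : IsPullback μ μ' p P P') {x : M'}
    (hP : ∃ U κ, IsOpen U ∧ p x ∈ U ∧ IsSmoothOn μ P U κ) :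
    ∃ U κ, IsOpen U ∧ x ∈ U ∧ IsSmoothOn μ' P' U κ := by
  obtain ⟨U, κ, hU, hxU, hκ, hPκ⟩ := hP
  obtain ⟨w, hw⟩ := hμ (p x)
  obtain ⟨r, e', w', he', hw', hxe'⟩ := exists_isSubmersionChart_hasDensityInChart hμ' hp
    ((isSmoothChart_chartAt (p x)).restrOpen hU) (x := x) ⟨mem_chart_source _ _, hxU⟩
  have hpU : MapsTo p e'.source U := fun y hy => (he'.mapsTo hy).2
  refine ⟨e'.source, κ ∘ p, e'.open_source, hxe', hκ.comp hp.contMDiff.contMDiffOn hpU,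
    fun f hf => ?_⟩
  have hpc : Continuous p := hp.contMDiff.continuous
  obtain ⟨g, hgf, hfg⟩ := he'.exists_chartDensity_eq_partialIntegral hpc (hw.restrOpen hU) hw' hf
  have hge := hgf.trans ((image_mono hf).trans he'.mapsTo.image_subset)
  have hint {u : M → ℂ} := he'.integral_comp_mul_eq (u := u) hpc (hw.restrOpen hU) hw' hf hge hfg
  rw [h.apply_eq hμ (g := g) fun u => hint u.2.1.continuous.continuousOn,
    hPκ g (hge.trans inter_subset_right)]
  exact (hint (hκ.continuousOn.mono inter_subset_right)).symm

theorem exists_isOpen_isFiberIntegral_testMul (hμ : IsSmoothDensity n μ)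
    (hμ' : IsSmoothDensity n' μ') (hp : Manifold.IsSubmersion (𝓡 n') (𝓡 n) ∞ p) (x : M') :
    ∃ W, IsOpen W ∧ x ∈ W ∧ ∀ {χ : M' → ℂ} (hχ : ContMDiff (𝓡 n') 𝓘(ℝ, ℂ) ∞ χ), tsupport χ ⊆ W →
      ∃ G : testFunctions n' M' → testFunctions n M,
        (∀ f, IsFiberIntegral μ μ' p (testMul hχ f) (G f)) ∧
        (∀ f, tsupport (G f : M → ℂ) ⊆ p '' tsupport (f : M' → ℂ)) ∧
        ∀ f, TendstoZero f → TendstoZero fun i => G (f i) := by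
  have hpc : Continuous p := hp.contMDiff.continuous
  obtain ⟨w, hw⟩ := hμ (p x)
  obtain ⟨r, e', w', he', hw', hxe'⟩ := exists_isSubmersionChart_hasDensityInChart hμ' hp
    (isSmoothChart_chartAt (p x)) (mem_chart_source _ (p x))
  refine ⟨e'.source, e'.open_source, hxe', fun hχ hχe => ?_⟩
  have hfe (f) := (tsupport_testMul_subset_left hχ f).trans hχe
  choose G hGf hG using fun f => he'.exists_chartDensity_eq_partialIntegral hpc hw hw' (hfe f)
  have hGp (f) := (hGf f).trans (image_mono (tsupport_testMul_subset_right hχ f))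
  refine ⟨G, fun f u => ?_, hGp, fun f hf => ?_⟩
  · exact he'.integral_comp_mul_eq hpc hw hw' (hfe f)
      ((hGf f).trans ((image_mono (hfe f)).trans he'.mapsTo.image_subset)) (hG f)
      u.2.1.continuous.continuousOn
  · obtain ⟨K, hK, hfK⟩ := hf.1
    have hχK (i) : tsupport (testMul hχ (f i) : M' → ℂ) ⊆ K ∩ tsupport _ :=
      subset_inter ((tsupport_testMul_subset_right hχ _).trans (hfK i))
        (tsupport_testMul_subset_left hχ _)
    exact he'.tendstoZero_of_chartDensity_eq hpc hw hw' (hK.inter_right (isClosed_tsupport _))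
      (inter_subset_right.trans hχe) (hf.testMul hχ) hχK
      (fun i => (hGf _).trans (image_mono (hχK i))) fun i => hG (f i)

variable [T2Space M'] [SecondCountableTopology M'] (hμ : IsSmoothDensity n μ)
  (hμ' : IsSmoothDensity n' μ') (hp : Manifold.IsSubmersion (𝓡 n') (𝓡 n) ∞ p)

include hμ hμ' hp

theorem exists_isFiberIntegral_of_isCompact {K : Set M'} (hK : IsCompact K) :
    ∃ G : testFunctions n' M' → testFunctions n M,
      (∀ f : testFunctions n' M', tsupport (f : M' → ℂ) ⊆ K → IsFiberIntegral μ μ' p f (G f)) ∧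
      (∀ f, tsupport (G f : M → ℂ) ⊆ p '' tsupport (f : M' → ℂ)) ∧
      ∀ f, TendstoZero f → TendstoZero fun i => G (f i) := by
  have := hμ.isLocallyFiniteMeasure
  have := hμ'.isLocallyFiniteMeasure
  have hpc : Continuous p := hp.contMDiff.continuous
  choose W hWo hxW hW using exists_isOpen_isFiberIntegral_testMul hμ hμ' hp
  obtain ⟨t, χ, hχ, hχW, hχK⟩ := exists_finset_contMDiff_sum_eq_one (n := n') hK W hWo hxW
  choose G hG hGs hG0 using fun x => hW x (hχ x) (hχW x)
  refine ⟨fun f => ∑ x ∈ t, G x f, fun f hf => ?_, fun f => ?_, fun f hf =>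
    TendstoZero.sum t fun x _ => hG0 x f hf⟩
  · simpa only [sum_testMul_eq_self hχ fun y hy => hχK y (hf hy)] using
      IsFiberIntegral.sum hpc t fun x => hG x f
  · refine closure_minimal (fun y hy => ?_) (f.2.2.isCompact.image hpc).isClosed
    rw [Function.mem_support, Submodule.coe_sum, Finset.sum_apply] at hy
    obtain ⟨x, _, hx⟩ := Finset.exists_ne_zero_of_sum_ne_zero hy
    exact hGs x f (subset_tsupport _ hx)

theorem exists_isFiberIntegral (f : testFunctions n' M') :
    ∃ g : testFunctions n M, IsFiberIntegral μ μ' p f g ∧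
      tsupport (g : M → ℂ) ⊆ p '' tsupport (f : M' → ℂ) := by
  obtain ⟨G, hG, hGs, _⟩ := exists_isFiberIntegral_of_isCompact hμ hμ' hp f.2.2.isCompact
  exact ⟨G f, hG f subset_rfl, hGs f⟩

theorem TendstoZero.of_isFiberIntegral {f : ℕ → testFunctions n' M'} (hf : TendstoZero f)
    {g : ℕ → testFunctions n M} (hg : ∀ i, IsFiberIntegral μ μ' p (f i) (g i)) :
    TendstoZero g := by
  have := hμ.isLocallyFiniteMeasure
  have := hμ.isOpenPosMeasure
  obtain ⟨K, hK, hfK⟩ := hf.1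
  obtain ⟨G, hG, _, hG0⟩ := exists_isFiberIntegral_of_isCompact hμ hμ' hp hK
  have hgG : g = fun i => G (f i) := funext fun i => (hg i).unique (hG _ (hfK i))
  exact hgG ▸ hG0 f hf

theorem existsUnique_isPullback (P : Distr n M) : ∃! P' : Distr n' M', IsPullback μ μ' p P P' := by
  have := hμ.isLocallyFiniteMeasure
  have := hμ.isOpenPosMeasure
  have := hμ'.isLocallyFiniteMeasure
  choose G hG _ using exists_isFiberIntegral hμ hμ' hp
  let T : testFunctions n' M' →ₗ[ℂ] testFunctions n M :=
    { toFun := G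
      map_add' := fun f₁ f₂ => (hG _).unique ((hG f₁).add hp.contMDiff.continuous (hG f₂))
      map_smul' := fun c f => (hG _).unique ((hG f).smul c) }
  refine ⟨⟨P.toLin ∘ₗ T, fun f hf => P.tendsto_zero _
    (hf.of_isFiberIntegral hμ hμ' hp fun i => hG (f i))⟩, fun f => ⟨G f, hG f, rfl⟩, ?_⟩
  rintro ⟨P', _⟩ hP'
  congr
  exact LinearMap.ext fun f => hP'.apply_eq hμ (hG f)

theorem IsPullback.support_subset {P : Distr n M} {P' : Distr n' M'}
    (h : IsPullback μ μ' p P P') : P'.support ⊆ p ⁻¹' P.support := fun x hx U hU => by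
  obtain ⟨f, hf, hf0⟩ := hx (p ⁻¹' U) (hp.contMDiff.continuous.continuousAt.preimage_mem_nhds hU)
  obtain ⟨g, hg, hgs⟩ := exists_isFiberIntegral hμ hμ' hp f
  exact ⟨g, hgs.trans (image_subset_iff.2 hf), h.apply_eq hμ hg ▸ hf0⟩

end Submersion

/-! ## Lifting adapted charts and total symbols -/

section Coordinates

/-- The reordering of the coordinates `((x, z), u) ↦ ((x, u), z)`, where `x` and `u` are the
coordinates along and transverse to a submanifold of the base of a submersion and `z` are the
coordinates along the fibres. The pair `(x, z)`, the coordinates along the inverse image of the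
submanifold, is encoded as one vector. -/
def adaptedCoordEquiv (d r k : ℕ) : (Euc (d + r) × Euc k) ≃L[ℝ] (Euc d × Euc k) × Euc r :=
  ((EuclideanSpace.finAddEquivProd.prodCongr (.refl ℝ (Euc k))).trans
    (.prodAssoc ℝ (Euc d) (Euc r) (Euc k))).trans
  (((ContinuousLinearEquiv.refl ℝ (Euc d)).prodCongr (.prodComm ℝ (Euc r) (Euc k))).trans
    (.symm (.prodAssoc ℝ (Euc d) (Euc k) (Euc r))))

theorem measurePreserving_finAddEquivProd (d r : ℕ) :
    MeasurePreserving (EuclideanSpace.finAddEquivProd : Euc (d + r) ≃L[ℝ] Euc d × Euc r) :=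
  (WithLp.volume_preserving_ofLp (Euc d) (Euc r)).comp
    ((LinearIsometryEquiv.piLpCongrLeft 2 ℝ ℝ finSumFinEquiv.symm).trans
      (PiLp.sumPiLpEquivProdLpPiLp 2 _)).measurePreserving

theorem measurePreserving_adaptedCoordEquiv (d r k : ℕ) :
    MeasurePreserving (adaptedCoordEquiv d r k) := by
  have hswap : MeasurePreserving (Prod.map id Prod.swap : Euc d × (Euc r × Euc k) → _) :=
    (MeasurePreserving.id volume).prod Measure.measurePreserving_swap
  exact (volume_preserving_prodAssoc.symm.comp hswap).comp (volume_preserving_prodAssoc.comp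
    ((measurePreserving_finAddEquivProd d r).prod (MeasurePreserving.id volume)))

end Coordinates

namespace IsSubmersionChart

variable {n n' : ℕ} {M M' : Type*} [TopologicalSpace M] [ChartedSpace (Euc n) M]
  [TopologicalSpace M'] [ChartedSpace (Euc n') M'] {p : M' → M} {V : Set M} {d k r : ℕ}
  {e : AdaptedChart n V d k} {e' : OpenPartialHomeomorph M' ((Euc d × Euc k) × Euc r)}

/-- The chart of the total space of a submersion lifting an adapted chart `e` of the base, as a
chart adapted to the inverse image of the submanifold. -/
def adaptedChart (h : IsSubmersionChart n n' p e.chart e') :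
    AdaptedChart n' (p ⁻¹' V) (d + r) k where
  chart := e'.transHomeomorph (adaptedCoordEquiv d r k).symm.toHomeomorph
  smooth := h.smooth'.transHomeomorph _
  mem_iff x hx := by
    rw [mem_preimage, e.mem_iff _ (h.mapsTo hx), ← h.fst_eq x hx]
    rfl

theorem fst_adaptedChart (h : IsSubmersionChart n n' p e.chart e') {x : M'} (hx : x ∈ e'.source) :
    (EuclideanSpace.finAddEquivProd (h.adaptedChart.chart x).1).1 = (e.chart (p x)).1 := by
  rw [← h.fst_eq x hx]
  exact congrArg (fun z => z.1.1) ((adaptedCoordEquiv d r k).apply_symm_apply (e' x))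

theorem snd_adaptedChart (h : IsSubmersionChart n n' p e.chart e') {x : M'} (hx : x ∈ e'.source) :
    (h.adaptedChart.chart x).2 = (e.chart (p x)).2 := by
  rw [← h.fst_eq x hx]
  rfl

variable {w' : (Euc d × Euc k) × Euc r → ℝ}

theorem chartDensity_adaptedChart (h : IsSubmersionChart n n' p e.chart e')
    (f : testFunctions n' M') (y : Euc d × Euc k) (z : Euc r) :
    chartDensity h.adaptedChart.chart (w' ∘ adaptedCoordEquiv d r k) f
        (EuclideanSpace.finAddEquivProd.symm (y.1, z), y.2) = chartDensity e' w' f (y, z) :=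
  congrArg (chartDensity e' w' f) ((adaptedCoordEquiv d r k).apply_symm_apply (y, z))

variable [MeasurableSpace M'] [BorelSpace M'] {μ' : Measure M'}

theorem hasDensityInChart_adaptedChart (h : IsSubmersionChart n n' p e.chart e')
    (hw' : HasDensityInChart μ' e' w') :
    HasDensityInChart μ' h.adaptedChart.chart (w' ∘ adaptedCoordEquiv d r k) := by
  have hw := hw'.transHomeomorph (adaptedCoordEquiv d r k) one_pos
    (by rw [one_smul, (measurePreserving_adaptedCoordEquiv d r k).map_eq])
  simp only [NNReal.coe_one, one_mul] at hw
  exact hw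

variable [T2Space M] [MeasurableSpace M] [BorelSpace M] {μ : Measure M}

theorem hasTotalSymbol (h : IsSubmersionChart n n' p e.chart e') (hw' : HasDensityInChart μ' e' w')
    (hμ : IsSmoothDensity n μ) (hp : ContMDiff (𝓡 n') (𝓡 n) ∞ p) {P : Distr n M}
    {P' : Distr n' M'} (hP : IsPullback μ μ' p P P') {m : ℂ} {a : Euc d → Euc k → ℂ}
    {A : ℕ → Euc d → Euc k → ℂ} (ha : HasTotalSymbol m μ P e a A) :
    HasTotalSymbol m μ' P' h.adaptedChart
      (fun x => a (EuclideanSpace.finAddEquivProd x).1)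
      (fun j x => A j (EuclideanSpace.finAddEquivProd x).1) := by
  obtain ⟨ha, w, κ, hw, hκ, hPf⟩ := ha
  have hw₁ := h.hasDensityInChart_adaptedChart hw'
  refine ⟨ha.comp_clm ((ContinuousLinearMap.fst ℝ (Euc d) (Euc r)).comp
      EuclideanSpace.finAddEquivProd.toContinuousLinearMap), _, κ ∘ p, hw₁,
    hκ.comp hp.contMDiffOn h.mapsTo, fun f hf => ?_⟩
  obtain ⟨g, hgf, hfg⟩ := h.exists_chartDensity_eq_partialIntegral hp.continuous hw hw' hf
  have hge := hgf.trans ((image_mono hf).trans h.mapsTo.image_subset)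
  have hint {u : M → ℂ} := h.integral_comp_mul_eq (u := u) hp.continuous hw hw' hf hge hfg
  rw [hP.apply_eq hμ (g := g) fun u => hint u.2.1.continuous.continuousOn, hPf g hge,
    ← hint hκ.continuousOn]
  congr 1
  have hS := (measurePreserving_finAddEquivProd d r).symm
    (EuclideanSpace.finAddEquivProd.toHomeomorph.toMeasurableEquiv)
  have hsymbol := symbolPairing_partialIntegral volume EuclideanSpace.finAddEquivProd.symm hS
    ha.hasPolynomialGrowth (contDiff_chartDensity h.adaptedChart.smooth hw₁ hf)
    (hasCompactSupport_chartDensity (e := h.adaptedChart.chart) hf)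
  refine Eq.trans (congrArg (symbolPairing a) (hfg.trans ?_)) hsymbol
  simp only [h.chartDensity_adaptedChart]

end IsSubmersionChart

theorem IsClosedSubmanifold.preimage {n n' : ℕ} {M M' : Type*} [TopologicalSpace M]
    [ChartedSpace (Euc n) M] [TopologicalSpace M'] [ChartedSpace (Euc n') M'] {p : M' → M}
    (hp : Manifold.IsSubmersion (𝓡 n') (𝓡 n) ∞ p) {V : Set M} {k : ℕ}
    (hV : IsClosedSubmanifold n V k) :
    IsClosedSubmanifold n' (p ⁻¹' V) k := by
  refine ⟨hV.1.preimage hp.contMDiff.continuous, fun x hx => ?_⟩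
  obtain ⟨d, e, he⟩ := hV.2 (p x) hx
  obtain ⟨r, e', h, hx', _⟩ := exists_isSubmersionChart hp e.smooth he univ_mem
  exact ⟨d + r, h.adaptedChart, hx'⟩

/-! ## The normal bundle of the inverse image -/

section TangentSubspace

variable {n n' : ℕ} {M M' : Type*} [TopologicalSpace M] [ChartedSpace (Euc n) M]
  [TopologicalSpace M'] [ChartedSpace (Euc n') M'] {p : M' → M} {V : Set M} {V' : Set M'} {x : M'}

theorem tangentSubspace_le_comap_mfderiv (hp : ContMDiffAt (𝓡 n') (𝓡 n) ∞ p x)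
    (hV : MapsTo p V' V) : tangentSubspace n' V' x ≤
      (tangentSubspace n V (p x)).comap (mfderiv (𝓡 n') (𝓡 n) p x).toLinearMap := by
  intro v hv f hf hf0
  have hfp := hv (f ∘ p) (hf.comp x hp)
    ((hp.continuousAt.continuousWithinAt.tendsto_nhdsWithin hV).eventually hf0)
  rwa [mfderiv_comp x (hf.mdifferentiableAt (by simp)) (hp.mdifferentiableAt (by simp))] at hfp

/-- The map of normal spaces induced by the differential at `x` of a map `p` that sends `V'`
into `V`. -/
def normalMap (hp : ContMDiffAt (𝓡 n') (𝓡 n) ∞ p x) (hV : MapsTo p V' V) :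
    NormalSpace n' V' x →ₗ[ℝ] NormalSpace n V (p x) :=
  Submodule.mapQ _ _ _ (tangentSubspace_le_comap_mfderiv hp hV)

variable {d d' k k' : ℕ}

theorem AdaptedChart.hasMFDerivAt_snd (e : AdaptedChart n V d k) {y : M} (hy : y ∈ e.chart.source) :
    HasMFDerivAt (𝓡 n) 𝓘(ℝ, Euc k) (fun z => (e.chart z).2) y (e.dNormal y) :=
  (ContinuousLinearMap.snd ℝ (Euc d) (Euc k)).hasMFDerivAt.comp y
    (e.mdiff.mdifferentiableAt hy).hasMFDerivAt

theorem dNormal_mfderiv (hp : ContMDiffAt (𝓡 n') (𝓡 n) ∞ p x) (e : AdaptedChart n V d k)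
    (e' : AdaptedChart n' V' d' k') (hx : x ∈ e'.chart.source) (hpx : p x ∈ e.chart.source)
    {H : Euc d' × Euc k' → Euc k} (hH : DifferentiableAt ℝ H (e'.chart x))
    (hHe : ∀ᶠ y in 𝓝 x, (e.chart (p y)).2 = H (e'.chart y)) (v : TangentSpace (𝓡 n') x) :
    e.dNormal (p x) (mfderiv (𝓡 n') (𝓡 n) p x v) =
      fderiv ℝ H (e'.chart x) (mfderiv (𝓡 n') 𝓘(ℝ, Euc d' × Euc k') e'.chart x v) := by
  have h₁ := (e.hasMFDerivAt_snd hpx).comp x (hp.mdifferentiableAt (by simp)).hasMFDerivAt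
  have h₂ := hH.hasFDerivAt.hasMFDerivAt.comp x (e'.mdiff.mdifferentiableAt hx).hasMFDerivAt
  exact congrArg (fun T => T v) (hasMFDerivAt_unique h₁ (h₂.congr_of_eventuallyEq hHe))

variable [IsManifold (𝓡 n) ∞ M] [IsManifold (𝓡 n') ∞ M']

theorem normalTriv_normalMap (hp : ContMDiffAt (𝓡 n') (𝓡 n) ∞ p x) (hV : MapsTo p V' V)
    (e : AdaptedChart n V d k) (e' : AdaptedChart n' V' d' k') (hx : x ∈ e'.chart.source)
    (hxV : x ∈ V') (hpx : p x ∈ e.chart.source) {H : Euc d' × Euc k' → Euc k}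
    (hH : DifferentiableAt ℝ H (e'.chart x))
    (hHe : ∀ᶠ y in 𝓝 x, (e.chart (p y)).2 = H (e'.chart y)) (ζ : NormalSpace n' V' x) :
    e.normalTriv (p x) hpx (hV hxV) (normalMap hp hV ζ) =
      fderiv ℝ H (e'.chart x) (0, e'.normalTriv x hx hxV ζ) := by
  have : IsManifold (𝓡 n') 1 M' := IsManifold.of_le (n := ∞) (by simp)
  obtain ⟨v, hv⟩ := e'.mdiff.mfderiv_surjective hx
    ((0, e'.normalTriv x hx hxV ζ) : Euc d' × Euc k')
  have hζ : ζ = Submodule.Quotient.mk v :=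
    (e'.normalTriv x hx hxV).injective (congrArg Prod.snd hv).symm
  rw [← hv, ← dNormal_mfderiv hp e e' hx hpx hH hHe, hζ]
  rfl

end TangentSubspace

section Submersion

variable {n n' : ℕ} {M M' : Type*}
  [TopologicalSpace M] [ChartedSpace (Euc n) M] [IsManifold (𝓡 n) ∞ M]
  [TopologicalSpace M'] [ChartedSpace (Euc n') M'] [IsManifold (𝓡 n') ∞ M']
  {p : M' → M} {V : Set M} {d k r : ℕ}

theorem IsSubmersionChart.normalTriv_normalMap {e : AdaptedChart n V d k}
    {e' : OpenPartialHomeomorph M' ((Euc d × Euc k) × Euc r)}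
    (h : IsSubmersionChart n n' p e.chart e') {x : M'} (hp : ContMDiffAt (𝓡 n') (𝓡 n) ∞ p x)
    (hx : x ∈ e'.source) (hxV : x ∈ p ⁻¹' V) (ζ : NormalSpace n' (p ⁻¹' V) x) :
    e.normalTriv (p x) (h.mapsTo hx) hxV (normalMap hp (mapsTo_preimage p V) ζ) =
      h.adaptedChart.normalTriv x hx hxV ζ := by
  refine (ConormalPullback.normalTriv_normalMap hp (mapsTo_preimage p V) e h.adaptedChart hx hxV
    (h.mapsTo hx) differentiableAt_snd ?_ ζ).trans (by rw [fderiv_snd]; rfl)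
  filter_upwards [e'.open_source.mem_nhds hx] with y hy
  exact (h.snd_adaptedChart hy).symm

variable (hp : Manifold.IsSubmersion (𝓡 n') (𝓡 n) ∞ p)

theorem normalMap_bijective (hV : IsClosedSubmanifold n V k) (x : ↥(p ⁻¹' V)) :
    Function.Bijective (normalMap (hp.contMDiff x) (mapsTo_preimage p V)) := by
  obtain ⟨d, e, he⟩ := hV.2 (p x) x.2
  obtain ⟨r, e', h, hx, _⟩ := exists_isSubmersionChart hp e.smooth he univ_mem
  refine ((e.normalTriv (p x) (h.mapsTo hx) x.2).bijective.of_comp_iff' _).1 ?_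
  convert (h.adaptedChart.normalTriv x hx x.2).bijective using 1
  exact funext (h.normalTriv_normalMap _ hx x.2)

/-- The isomorphism of normal spaces induced by the differential of a submersion. -/
def normalEquiv (hV : IsClosedSubmanifold n V k) (x : ↥(p ⁻¹' V)) :
    NormalSpace n' (p ⁻¹' V) (x : M') ≃ₗ[ℝ] NormalSpace n V (p x) :=
  LinearEquiv.ofBijective _ (normalMap_bijective hp hV x)

variable (hV : IsClosedSubmanifold n V k)

theorem isSmoothNormalIso_normalEquiv : IsSmoothNormalIso p V k (normalEquiv hp hV) := by
  intro d d' e e'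
  set O := e'.chart.target ∩ e'.chart.symm ⁻¹' (p ⁻¹' e.chart.source)
  have hO : IsOpen O := e'.chart.isOpen_inter_preimage_symm
    (e.chart.open_source.preimage hp.contMDiff.continuous)
  set H : Euc d' × Euc k → Euc k := fun z => (e.chart (p (e'.chart.symm z))).2
  have hH : ContDiffOn ℝ ∞ H O := contDiff_snd.comp_contDiffOn <| contMDiffOn_iff_contDiffOn.1 <|
    e.smooth.contMDiffOn.comp (hp.contMDiff.comp_contMDiffOn
      (e'.smooth.contMDiffOn_symm.mono inter_subset_left)) fun _ hz => hz.2
  have hmaps {x} (hx : x ∈ e'.chart.source) (hpx : p x ∈ e.chart.source) : e'.chart x ∈ O :=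
    ⟨e'.chart.map_source hx, by rwa [mem_preimage, e'.chart.left_inv hx]⟩
  refine ⟨fun x => (fderiv ℝ H (e'.chart x)).comp (ContinuousLinearMap.inr ℝ (Euc d') (Euc k)),
    ?_, fun x hx hpx ζ => ?_⟩
  · have hdH : ContDiffOn ℝ ∞
        (fun z => (fderiv ℝ H z).comp (ContinuousLinearMap.inr ℝ (Euc d') (Euc k))) O :=
      (hH.fderiv_of_isOpen hO (by simp)).clm_comp contDiffOn_const
    exact hdH.contMDiffOn.comp (e'.smooth.contMDiffOn.mono fun x hx => hx.2.1)
      fun x hx => hmaps hx.2.1 hx.2.2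
  · refine normalTriv_normalMap (hp.contMDiff x) (mapsTo_preimage p V) e e' hx x.2 hpx
      ((hH.contDiffAt (hO.mem_nhds (hmaps hx hpx))).differentiableAt (by simp)) ?_ ζ
    filter_upwards [e'.chart.open_source.mem_nhds hx] with y hy
    simp only [H, e'.chart.left_inv hy]

namespace IsSubmersionChart

variable {e : AdaptedChart n V d k} {e' : OpenPartialHomeomorph M' ((Euc d × Euc k) × Euc r)}
  (h : IsSubmersionChart n n' p e.chart e') {x : ↥(p ⁻¹' V)} (hx : (x : M') ∈ e'.source)

theorem frameVolume_normalEquiv (b : Fin k → NormalSpace n' (p ⁻¹' V) (x : M')) :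
    e.frameVolume (p x) (h.mapsTo hx) x.2 (fun i => normalEquiv hp hV x (b i)) =
      h.adaptedChart.frameVolume x hx x.2 b := by
  simp only [AdaptedChart.frameVolume, normalEquiv, LinearEquiv.ofBijective_apply,
    h.normalTriv_normalMap _ hx x.2]

theorem covector_comp_normalEquiv_symm (ξ : Euc k) :
    h.adaptedChart.covector x hx x.2 ξ ∘ₗ (normalEquiv hp hV x).symm.toLinearMap =
      e.covector (p x) (h.mapsTo hx) x.2 ξ := by
  refine (LinearEquiv.comp_toLinearMap_symm_eq _ _).2 (LinearMap.ext fun ζ => ?_)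
  exact congrArg (innerSL ℝ ξ) (h.normalTriv_normalMap (hp.contMDiff x) hx x.2 ζ).symm

end IsSubmersionChart

end Submersion

/-! ## Pull-back of conormal distributions and of their principal symbols -/

variable {n n' k : ℕ} {M M' : Type*}
  [TopologicalSpace M] [ChartedSpace (Euc n) M] [IsManifold (𝓡 n) ∞ M]
  [TopologicalSpace M'] [ChartedSpace (Euc n') M'] [IsManifold (𝓡 n') ∞ M']
  {p : M' → M} {V : Set M} {ρ : ∀ y : V, (Fin k → NormalSpace n V (y : M)) → ℝ}

theorem IsNormalDensity.pullback (hp : Manifold.IsSubmersion (𝓡 n') (𝓡 n) ∞ p)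
    (hV : IsClosedSubmanifold n V k) (hρ : IsNormalDensity n V k ρ) :
    IsNormalDensity n' (p ⁻¹' V) k
      (fun x b => ρ ⟨p x, x.2⟩ fun i => normalEquiv hp hV x (b i)) := by
  intro x
  obtain ⟨d, e, r, he, hr, hr0, hρr⟩ := hρ ⟨p x, x.2⟩
  obtain ⟨_, e', h, hx, _⟩ := exists_isSubmersionChart hp e.smooth he univ_mem
  refine ⟨_, h.adaptedChart, r ∘ p, hx, hr.comp hp.contMDiff.contMDiffOn h.mapsTo,
    fun y hy => hr0 _ (h.mapsTo hy), fun y hy b => ?_⟩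
  rw [← h.frameVolume_normalEquiv hp hV hy]
  exact hρr ⟨p y, y.2⟩ (h.mapsTo hy) fun i => normalEquiv hp hV y (b i)

variable [T2Space M] [MeasurableSpace M] [BorelSpace M] [MeasurableSpace M'] [BorelSpace M']
  {μ : Measure M} {μ' : Measure M'} {m : ℂ} {P : Distr n M} {P' : Distr n' M'}

theorem IsConormal.pullback (hμ : IsSmoothDensity n μ) (hμ' : IsSmoothDensity n' μ')
    (hp : Manifold.IsSubmersion (𝓡 n') (𝓡 n) ∞ p) (hP : IsConormal m μ V k P)
    (hPP' : IsPullback μ μ' p P P') : IsConormal m μ' (p ⁻¹' V) k P' := by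
  refine ⟨fun x hx => hPP'.exists_isSmoothOn hμ hμ' hp (hP.1 (p x) hx), fun x hx => ?_⟩
  obtain ⟨d, e, a, A, he, ha⟩ := hP.2 (p x) hx
  obtain ⟨_, e', w', h, hw', hx'⟩ := exists_isSubmersionChart_hasDensityInChart hμ' hp e.smooth he
  exact ⟨_, h.adaptedChart, _, _, hx', h.hasTotalSymbol hw' hμ hp.contMDiff hPP' ha⟩

theorem HasPrincipalSymbol.pullback (hμ : IsSmoothDensity n μ) (hμ' : IsSmoothDensity n' μ')
    (hp : Manifold.IsSubmersion (𝓡 n') (𝓡 n) ∞ p) (hV : IsClosedSubmanifold n V k)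
    {σ : ∀ y : V, Module.Dual ℝ (NormalSpace n V (y : M)) → ℂ}
    (hσ : HasPrincipalSymbol m μ V k ρ P σ) (hPP' : IsPullback μ μ' p P P') :
    HasPrincipalSymbol m μ' (p ⁻¹' V) k
      (fun x b => ρ ⟨p x, x.2⟩ fun i => normalEquiv hp hV x (b i)) P'
      (fun x η => σ ⟨p x, x.2⟩ (η ∘ₗ (normalEquiv hp hV x).symm.toLinearMap)) := by
  refine ⟨fun x hx => hPP'.exists_isSmoothOn hμ hμ' hp (hσ.1 (p x) hx), fun x hx => ?_⟩
  obtain ⟨d, e, a, A, he, ha, hσa⟩ := hσ.2 (p x) hx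
  obtain ⟨_, e', w', h, hw', hx'⟩ := exists_isSubmersionChart_hasDensityInChart hμ' hp e.smooth he
  refine ⟨_, h.adaptedChart, _, _, hx', h.hasTotalSymbol hw' hμ hp.contMDiff hPP' ha,
    fun y hy ξ hξ b => ?_⟩
  have hσy := hσa ⟨p y, y.2⟩ (h.mapsTo hy) ξ hξ fun i => normalEquiv hp hV y (b i)
  rw [h.frameVolume_normalEquiv hp hV hy, ← h.covector_comp_normalEquiv_symm hp hV hy,
    ← h.fst_adaptedChart hy] at hσy
  exact hσy

end ConormalPullback

end

open ConormalPullback in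
theorem mainTheorem7_general {n n' k : ℕ} {M M' : Type*}
    [TopologicalSpace M] [ChartedSpace (Euc n) M] [IsManifold (𝓡 n) ∞ M]
    [T2Space M] [MeasurableSpace M] [BorelSpace M]
    [TopologicalSpace M'] [ChartedSpace (Euc n') M'] [IsManifold (𝓡 n') ∞ M']
    [T2Space M'] [SecondCountableTopology M'] [MeasurableSpace M'] [BorelSpace M']
    (μ : Measure M) (hμ : IsSmoothDensity n μ) (μ' : Measure M') (hμ' : IsSmoothDensity n' μ')
    (p : M' → M) (hp : Manifold.IsSubmersion (𝓡 n') (𝓡 n) ∞ p)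
    (V : Set M) (hV : IsClosedSubmanifold n V k) :
    IsClosedSubmanifold n' (p ⁻¹' V) k ∧
    ∃ Φ : ∀ x : ↥(p ⁻¹' V), NormalSpace n' (p ⁻¹' V) (x : M') ≃ₗ[ℝ] NormalSpace n V (p x),
      (∀ (x : ↥(p ⁻¹' V)) (v : TangentSpace (𝓡 n') (x : M')),
        Φ x (Submodule.Quotient.mk v) =
          Submodule.Quotient.mk (mfderiv (𝓡 n') (𝓡 n) p (x : M') v)) ∧
      IsSmoothNormalIso p V k Φ ∧
      (∀ P : Distr n M, ∃! P' : Distr n' M', IsPullback μ μ' p P P') ∧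
      ∀ (m : ℂ) (P : Distr n M) (P' : Distr n' M'),
        IsConormal m μ V k P → IsPullback μ μ' p P P' →
        IsConormal m μ' (p ⁻¹' V) k P' ∧
        (IsCompact (p ⁻¹' P.support) → IsConormalC m μ' (p ⁻¹' V) k P') ∧
        ∀ ρ : ∀ y : V, (Fin k → NormalSpace n V (y : M)) → ℝ, IsNormalDensity n V k ρ →
          IsNormalDensity n' (p ⁻¹' V) k (fun x b => ρ ⟨p x, x.2⟩ fun i => Φ x (b i)) ∧
          ∀ σ : ∀ y : V, Module.Dual ℝ (NormalSpace n V (y : M)) → ℂ,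
            HasPrincipalSymbol m μ V k ρ P σ →
            HasPrincipalSymbol m μ' (p ⁻¹' V) k (fun x b => ρ ⟨p x, x.2⟩ fun i => Φ x (b i)) P'
              (fun x η => σ ⟨p x, x.2⟩ (η ∘ₗ (Φ x).symm.toLinearMap)) := by
  refine ⟨hV.preimage hp, normalEquiv hp hV, fun _ _ => rfl, isSmoothNormalIso_normalEquiv hp hV,
    existsUnique_isPullback hμ hμ' hp, fun m P P' hP hPP' => ?_⟩
  have hP' : IsConormal m μ' (p ⁻¹' V) k P' := hP.pullback hμ hμ' hp hPP'
  have hsupp : P'.support ⊆ p ⁻¹' P.support := hPP'.support_subset hμ hμ' hp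
  exact ⟨hP', fun hc => ⟨hP', hc.of_isClosed_subset (isClosed_support P') hsupp⟩,
    fun ρ hρ => ⟨hρ.pullback hp hV, fun σ hσ => hσ.pullback hμ hμ' hp hV hPP'⟩⟩

open ConormalPullback in
theorem mainTheorem7 {n n' k : ℕ} {M M' : Type*}
    [TopologicalSpace M] [ChartedSpace (Euc n) M] [IsManifold (𝓡 n) ∞ M]
    [T2Space M] [SecondCountableTopology M] [MeasurableSpace M] [BorelSpace M]
    [TopologicalSpace M'] [ChartedSpace (Euc n') M'] [IsManifold (𝓡 n') ∞ M']
    [T2Space M'] [SecondCountableTopology M'] [MeasurableSpace M'] [BorelSpace M']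
    (μ : Measure M) (hμ : IsSmoothDensity n μ) (μ' : Measure M') (hμ' : IsSmoothDensity n' μ')
    (p : M' → M) (hp : Manifold.IsSubmersion (𝓡 n') (𝓡 n) ∞ p)
    (V : Set M) (hV : IsClosedSubmanifold n V k) :
    -- `p⁻¹(V)` is a closed submanifold, and the differential of `p` induces an isomorphism from
    -- its normal bundle to the pull-back of the normal bundle of `V`
    IsClosedSubmanifold n' (p ⁻¹' V) k ∧
    ∃ Φ : ∀ x : ↥(p ⁻¹' V), NormalSpace n' (p ⁻¹' V) (x : M') ≃ₗ[ℝ] NormalSpace n V (p x),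
      (∀ (x : ↥(p ⁻¹' V)) (v : TangentSpace (𝓡 n') (x : M')),
        Φ x (Submodule.Quotient.mk v) =
          Submodule.Quotient.mk (mfderiv (𝓡 n') (𝓡 n) p (x : M') v)) ∧
      IsSmoothNormalIso p V k Φ ∧
      -- the pull-back of distributions by `p` is well defined
      (∀ P : Distr n M, ∃! P' : Distr n' M', IsPullback μ μ' p P P') ∧
      -- the pull-back of a conormal distribution
      ∀ (m : ℂ) (P : Distr n M) (P' : Distr n' M'),
        IsConormalC m μ V k P → IsPullback μ μ' p P P' →
        IsConormal m μ' (p ⁻¹' V) k P' ∧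
        (IsCompact (p ⁻¹' P.support) → IsConormalC m μ' (p ⁻¹' V) k P') ∧
        -- its principal symbol
        ∀ ρ : ∀ y : V, (Fin k → NormalSpace n V (y : M)) → ℝ, IsNormalDensity n V k ρ →
          IsNormalDensity n' (p ⁻¹' V) k (fun x b => ρ ⟨p x, x.2⟩ fun i => Φ x (b i)) ∧
          ∀ σ : ∀ y : V, Module.Dual ℝ (NormalSpace n V (y : M)) → ℂ,
            HasPrincipalSymbol m μ V k ρ P σ →
            HasPrincipalSymbol m μ' (p ⁻¹' V) k (fun x b => ρ ⟨p x, x.2⟩ fun i => Φ x (b i)) P'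
              (fun x η => σ ⟨p x, x.2⟩ (η ∘ₗ (Φ x).symm.toLinearMap)) := by
  obtain ⟨hV', Φ, hΦ, hΦs, hex, h⟩ := mainTheorem7_general μ hμ μ' hμ' p hp V hV
  exact ⟨hV', Φ, hΦ, hΦs, hex, fun m P P' hP => h m P P' hP.1⟩
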